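/- Let $d\ge 1$, $s\in(0,1)$, and let $\Omega\subset\mathbb{R}^d$ be an open set with a finite conforming simplicial triangulation $\mathcal P_h$: its elements are open nondegenerate $d$-simplices, the closed elements cover exactly $\overline\Omega$, and any two distinct closed elements meet in a common (possibly empty) proper face. For each node $z$ let $\phi_z$ be the piecewise linear Lagrange basis function of $z$, i.e. the continuous function on $\overline\Omega$ that is affine on each closed element, equals $1$ at $z$ and $0$ at all other nodes, extended by zero to $\mathbb{R}^d\setminus\overline\Omega$. Let $X_h=\operatorname{span}\{\phi_z\}$, and let $V_h=X_h$ if $s<1/2$ and $V_h=\{v\in X_h: v=0\text{ on }\partial\Omega\}$ if $s\ge 1/2$. Define $$(-\Delta)^s u(x)=C(d,s)\ \mathrm{p.v.}\!\int_{\mathbb{R}^d}\frac{u(x)-u(y)}{|x-y|^{d+2s}}\,dy,\qquad C(d,s)=\frac{2^{2s}s\,\Gamma(s+d/2)}{\pi^{d/2}\,\Gamma(1-s)},$$ where the principal value is the limit as $\varepsilon\to0^+$ of the (absolutely convergent) integrals over $|x-y|\ge\varepsilon$. Let $n_y$ be the outward unit normal on $\partial K$, and let boundary integrals be taken with respect to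 the $(d-1)$-dimensional surface measure (the counting measure if $d=1$). Let $u\in V_h$, let $K_0\in\mathcal P_h$ and let $x$ be a point of the (open) element $K_0$. Then $u$ has a constant gradient $\nabla u|_K$ on each element $K$, the principal value defining $(-\Delta)^su(x)$ exists, the integrands of all boundary integrals below are regular (on each closed facet of the element they are continuous and integrable), and the following holds. If $s\ne 1-d/2$, then $$\begin{aligned}\frac{(-\Delta)^su(x)}{C(d,s)}={}&\frac1{d+2s-2}\int_{\partial K_0}\frac{\nabla u|_{K_0}\cdot n_y}{|x-y|^{d+2s-2}}\,dy-\frac{u(x)}{2s}\int_{\partial K_0}\frac{n_y\cdot(x-y)}{|x-y|^{d+2s}}\,dy\\&+\sum_{K\ne K_0}\left\{\frac1{2s(d+2s-2)}\int_{\partial K}\frac{\nabla u|_K\cdot n_y}{|x-y|^{d+2s-2}}\,dy-\frac1{2s}\int_{\partial K}u(y)\frac{n_y\cdot(x-y)}{|x-y|^{d+2s}}\,dy\right\}.\end{aligned}$$ If $s=1-d/2$, then $$\begin{aligned}\frac{(-\Delta)^su(x)}{C(d,s)}={}&\int_{\partial K_0}\nabla u|_{K_0}\cdot n_y\,\log\frac1{|x-y|}\,dy-\frac{u(x)}{2s}\int_{\partial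 K_0}\frac{n_y\cdot(x-y)}{|x-y|^{d+2s}}\,dy\\&+\sum_{K\ne K_0}\left\{\frac1{2s}\int_{\partial K}\nabla u|_K\cdot n_y\,\log\frac1{|x-y|}\,dy-\frac1{2s}\int_{\partial K}u(y)\frac{n_y\cdot(x-y)}{|x-y|^{2}}\,dy\right\}.\end{aligned}$$ -/

import Mathlib

open MeasureTheory Filter Topology

noncomputable section

namespace FracLap

/-- Euclidean space of dimension `d`. -/
abbrev E (d : ℕ) : Type := EuclideanSpace ℝ (Fin d)

/-! ### The fractional Laplacian -/

/-- The normalisation constant of the fractional Laplacian,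
`C(d,s) = 2^(2s) s Γ(s + d/2) / (π^(d/2) Γ(1 - s))`. -/
def C (d : ℕ) (s : ℝ) : ℝ :=
  (2 : ℝ) ^ (2 * s) * s * Real.Gamma (s + (d : ℝ) / 2) /
    (Real.pi ^ ((d : ℝ) / 2) * Real.Gamma (1 - s))

/-- `I` is the Cauchy principal value of `∫ f` over the whole space, with a singularity at `x`:
`f` is integrable outside every ball around `x`, and the integrals outside the balls of radius `ε`
converge to `I` as `ε → 0+`. -/
def HasPrincipalValue {d : ℕ} (f : E d → ℝ) (x : E d) (I : ℝ) : Prop :=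
  (∀ ε : ℝ, 0 < ε → IntegrableOn f (Metric.ball x ε)ᶜ volume) ∧
    Tendsto (fun ε : ℝ => ∫ y in (Metric.ball x ε)ᶜ, f y) (𝓝[>] 0) (𝓝 I)

/-- The fractional Laplacian `(-Δ)^s u` exists at `x` (as a principal value) and equals `L`. -/
def HasFracLaplacianAt {d : ℕ} (s : ℝ) (u : E d → ℝ) (x : E d) (L : ℝ) : Prop :=
  ∃ I : ℝ, HasPrincipalValue (fun y => (u x - u y) / ‖x - y‖ ^ ((d : ℝ) + 2 * s)) x I ∧
    L = C d s * I

/-! ### Integrals over the boundary of a simplex -/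

/-- The outward unit normal of a nondegenerate simplex on the facet opposite to its `j`-th vertex:
the direction from that vertex to its orthogonal projection onto the facet. -/
def outwardNormal {d : ℕ} [NeZero d] (K : Affine.Simplex ℝ (E d) d) (j : Fin (d + 1)) : E d :=
  ‖K.altitudeFoot j - K.points j‖⁻¹ • (K.altitudeFoot j - K.points j)

/-- The (closed) facet of a simplex opposite to its `j`-th vertex. -/
def facet {d : ℕ} [NeZero d] (K : Affine.Simplex ℝ (E d) d) (j : Fin (d + 1)) : Set (E d) :=
  (K.faceOpposite j).closedInterior

/-- The integral `∫_{∂K} g(y, n_y) dy` with respect to the `(d-1)`-dimensional surface measure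
(the counting measure if `d = 1`), where `n_y` is the outward unit normal. -/
def boundaryIntegral {d : ℕ} [NeZero d] (K : Affine.Simplex ℝ (E d) d)
    (g : E d → E d → ℝ) : ℝ :=
  ∑ j : Fin (d + 1), ∫ y in facet K j, g y (outwardNormal K j) ∂μHE[d - 1]

/-- The integrand of `∫_{∂K} g(y, n_y) dy` is regular: on each closed facet it is continuous and
integrable with respect to the surface measure. -/
def BoundaryRegular {d : ℕ} [NeZero d] (K : Affine.Simplex ℝ (E d) d)
    (g : E d → E d → ℝ) : Prop :=
  ∀ j : Fin (d + 1), ContinuousOn (fun y => g y (outwardNormal K j)) (facet K j) ∧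
    IntegrableOn (fun y => g y (outwardNormal K j)) (facet K j) μHE[d - 1]

/-! ### Triangulations and finite element functions -/

/-- The vertices of a nondegenerate `d`-simplex in `ℝ^d`, as an affine basis; its coordinate
functions are the barycentric coordinates. -/
def simplexBasis {d : ℕ} (K : Affine.Simplex ℝ (E d) d) :
    AffineBasis (Fin (d + 1)) ℝ (E d) :=
  ⟨K.points, K.independent, K.span_eq_top (by simp)⟩

/-- A conforming triangulation of `Ω` with elements `K_i`, `i ∈ ι`. The element itself is the open
simplex `(cell i).interior`, its closure is `(cell i).closedInterior`. -/
structure Triangulation {d : ℕ} (Ω : Set (E d)) (ι : Type*) where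
  /-- the elements, as nondegenerate `d`-simplices -/
  cell : ι → Affine.Simplex ℝ (E d) d
  /-- the domain is open -/
  isOpen_domain : IsOpen Ω
  /-- the closed elements cover exactly the closure of the domain -/
  closure_domain : closure Ω = ⋃ i, (cell i).closedInterior
  /-- no element is listed twice -/
  distinct : ∀ i j, Set.range (cell i).points = Set.range (cell j).points → i = j
  /-- two closed elements meet in a common (possibly empty) face -/
  conforming : ∀ i j, (cell i).closedInterior ∩ (cell j).closedInterior =
    convexHull ℝ (Set.range (cell i).points ∩ Set.range (cell j).points)

namespace Triangulation

variable {d : ℕ} {Ω : Set (E d)} {ι : Type*}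

/-- The nodes of the triangulation. -/
def nodes (T : Triangulation Ω ι) : Set (E d) := ⋃ i, Set.range (T.cell i).points

open Classical in
/-- The piecewise linear Lagrange basis function of the node `z`: on a closed element that has `z`
as a vertex it is the barycentric coordinate belonging to `z`, and it is zero elsewhere (in
particular outside the closure of the domain). It does not depend on the element that is chosen,
see `nodalFunction_eq`. -/
def nodalFunction (T : Triangulation Ω ι) (z y : E d) : ℝ :=
  if h : ∃ p : ι × Fin (d + 1), (T.cell p.1).points p.2 = z ∧ y ∈ (T.cell p.1).closedInterior then
    (simplexBasis (T.cell h.choose.1)).coord h.choose.2 y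
  else 0

/-- The continuous piecewise linear functions: the span of the Lagrange basis functions. -/
def lagrangeSpace (T : Triangulation Ω ι) : Submodule ℝ (E d → ℝ) :=
  Submodule.span ℝ (T.nodalFunction '' T.nodes)

/-- The finite element space `V_h`: all of the Lagrange space if `s < 1/2`, and its subspace of
functions that vanish on `∂Ω` if `s ≥ 1/2`. -/
def feSpace (T : Triangulation Ω ι) (s : ℝ) : Submodule ℝ (E d → ℝ) where
  carrier := {v | v ∈ T.lagrangeSpace ∧ (1 / 2 ≤ s → ∀ y ∈ frontier Ω, v y = 0)}
  add_mem' := fun ⟨ha, ha'⟩ ⟨hb, hb'⟩ => ⟨add_mem ha hb, fun h y hy => by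
    simp [ha' h y hy, hb' h y hy]⟩
  zero_mem' := ⟨zero_mem _, fun _ _ _ => rfl⟩
  smul_mem' := fun c _ ⟨ha, ha'⟩ => ⟨Submodule.smul_mem _ c ha, fun h y hy => by
    simp [ha' h y hy]⟩

/-- The constant gradient `∇u|_K` of a piecewise linear function on an element, evaluated at the
centroid of the element. -/
def cellGradient (T : Triangulation Ω ι) (u : E d → ℝ) (i : ι) : E d :=
  gradient u (T.cell i).centroid

/-- On an element with vertex `z`, the Lagrange basis function of `z` is the barycentric
coordinate of `z`. -/
theorem nodalFunction_eq (T : Triangulation Ω ι) (i : ι) (j : Fin (d + 1)) {y : E d}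
    (hy : y ∈ (T.cell i).closedInterior) :
    T.nodalFunction ((T.cell i).points j) y = (simplexBasis (T.cell i)).coord j y := by
  have h : ∃ p : ι × Fin (d + 1), (T.cell p.1).points p.2 = (T.cell i).points j ∧
      y ∈ (T.cell p.1).closedInterior := ⟨(i, j), rfl, hy⟩
  rw [nodalFunction, dif_pos h]
  obtain ⟨hz, hy'⟩ := h.choose_spec
  set k := h.choose.1
  set l := h.choose.2
  have hmem := convexHull_subset_affineSpan (𝕜 := ℝ) _
    ((T.conforming k i).le ⟨hy', hy⟩)
  refine AffineMap.eqOn_affineSpan ?_ hmem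
  rintro w ⟨⟨a, ha⟩, ⟨b, hb⟩⟩
  have e1 : (simplexBasis (T.cell k)).coord l w = if l = a then 1 else 0 := by
    rw [← ha]; exact (simplexBasis (T.cell k)).coord_apply l a
  have e2 : (simplexBasis (T.cell i)).coord j w = if j = b then 1 else 0 := by
    rw [← hb]; exact (simplexBasis (T.cell i)).coord_apply j b
  rw [e1, e2]
  have : l = a ↔ j = b := by
    rw [← (T.cell k).independent.injective.eq_iff, ← (T.cell i).independent.injective.eq_iff,
      ha, hb]
    rw [hz]
  simp [this]

/-- The Lagrange basis function of `z` vanishes on every element that does not have `z` as a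
vertex. -/
theorem nodalFunction_eq_zero (T : Triangulation Ω ι) (i : ι) {z y : E d}
    (hz : z ∉ Set.range (T.cell i).points) (hy : y ∈ (T.cell i).closedInterior) :
    T.nodalFunction z y = 0 := by
  by_cases h : ∃ p : ι × Fin (d + 1), (T.cell p.1).points p.2 = z ∧
      y ∈ (T.cell p.1).closedInterior
  · obtain ⟨⟨k, l⟩, hkl, hy'⟩ := h
    rw [← hkl, T.nodalFunction_eq k l hy']
    have hmem := convexHull_subset_affineSpan (𝕜 := ℝ) _ ((T.conforming k i).le ⟨hy', hy⟩)
    refine AffineMap.eqOn_affineSpan (g := AffineMap.const ℝ (E d) (0 : ℝ)) ?_ hmem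
    rintro w ⟨⟨a, ha⟩, hw⟩
    have e1 : (simplexBasis (T.cell k)).coord l w = if l = a then 1 else 0 := by
      rw [← ha]; exact (simplexBasis (T.cell k)).coord_apply l a
    have : l ≠ a := by
      rintro rfl
      exact hz (by rw [← hkl]; exact ha ▸ hw)
    simp [e1, this]
  · rw [nodalFunction, dif_neg h]

end Triangulation

end FracLap

end

noncomputable section

namespace FracLap

/-! ### Slicing Lebesgue measure by parallel hyperplanes -/

open Module


/-! Write k(y) = |x - y|^(-d-2s) and let G be a function on (0, ∞) with G'(t) = -t^(-(d+2s)/2). Away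
from x two identities hold: the gradient of G(|y - x|²) is -2 k(y) (y - x), and, k being homogeneous
of degree -d-2s, the divergence of k(y) (y - x) is -2s k(y). For an affine function l(y) = c + a·(y
- x) the second gives div(l k (y - x)) = -2s l k + k a·(y - x), and the first turns the last term
into the flux of a multiple of G a. Hence the integral of l k over an element that avoids x is a
combination of two boundary integrals (`integral_cell_affine_mul_kernel`).

On the element K₀ of x, u(x) - u(y) is a linear function of y - x, so by oddness small balls
contribute nothing and the integral outside the ball of radius ε is constant for small ε
(`integral_cell_diff_ball_linear_mul_kernel`). This is why the principal value exists. Outside K₀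
the constant u(x) is integrated against k over the whole complement, which is a flux through ∂K₀
because the flux at infinity vanishes (`integral_compl_cell_kernel`); the function u contributes the
integrals over the other elements. `Triangulation.hasPrincipalValue` collects these terms. The two
formulas of the theorem differ only in G: a power of t, or -log t when d + 2s = 2.

The singularity at x is avoided by replacing the radial profiles near 0 by C¹ ones, so the only tool
needed is the divergence theorem for C¹ fields on a simplex (`integral_fderiv_simplex`). It follows
from Fubini and the fundamental theorem of calculus on lines parallel to an edge, because the edges
span the space. -/

/-- Slicing the volume along a direction `w` transversal to a hyperplane with unit normal `n`. -/
theorem measurePreserving_hyperplane_slice {V : Type*} [NormedAddCommGroup V]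
    [InnerProductSpace ℝ V] [MeasurableSpace V] [BorelSpace V] [FiniteDimensional ℝ V]
    {n w : V} (hn : ‖n‖ = 1) (hw : inner ℝ w n ≠ 0) (q : V) :
    MeasurePreserving (fun zt : (ℝ ∙ n)ᗮ × ℝ => q + (zt.1 : V) + zt.2 • w)
      (ENNReal.ofReal |inner ℝ w n| • (volume : Measure ((ℝ ∙ n)ᗮ × ℝ))) volume := by
  set c := inner ℝ w n with hc
  have hn0 : n ≠ 0 := by rintro rfl; simp at hn
  -- the orthogonal parametrisation
  let n' : (ℝ ∙ n) := ⟨n, Submodule.mem_span_singleton_self n⟩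
  have h1 : MeasurePreserving (fun t : ℝ => t • n') volume volume := by
    refine ⟨by fun_prop, ?_⟩
    have := volume_eq_of_finrank_eq_one (E := (ℝ ∙ n)) (finrank_span_singleton hn0) (v := n')
      (by simpa [n', Subtype.ext_iff] using hn0)
    rw [this]
    have : ‖n'‖ₑ = 1 := by
      rw [← ofReal_norm]; simp [n', hn]
    rw [this, one_smul]
  have h2 : MeasurePreserving (fun zt : (ℝ ∙ n)ᗮ × ℝ => q + (zt.1 : V) + zt.2 • n)
      volume volume := by
    have e := ((ℝ ∙ n).measurePreserving_measurableEquivProd q).symm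
    rw [InnerProductSpace.euclideanHausdorffMeasure_eq_volume] at e
    have e2 := e.comp ((h1.prod (MeasurePreserving.id (volume : Measure (ℝ ∙ n)ᗮ))).comp
      (Measure.measurePreserving_swap (μ := (volume : Measure (ℝ ∙ n)ᗮ)) (ν := (volume : Measure ℝ))))
    have e3 : (fun zt : (ℝ ∙ n)ᗮ × ℝ => q + (zt.1 : V) + zt.2 • n) =
        ⇑((ℝ ∙ n).measurableEquivProd q).symm ∘ Prod.map (fun t => t • n') id ∘ Prod.swap := by
      ext zt
      simp only [Function.comp_apply, Prod.map, Prod.swap, id,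
        Submodule.measurableEquivProd_symm_apply, Submodule.coe_smul, vadd_eq_add, n']
      abel
    rw [e3]
    exact e2
  -- the shear
  have hproj : w - c • n ∈ (ℝ ∙ n)ᗮ := by
    rw [Submodule.mem_orthogonal_singleton_iff_inner_left, inner_sub_left, inner_smul_left]
    simp [hn, ← hc]
  let w' : (ℝ ∙ n)ᗮ := ⟨w - c • n, hproj⟩
  have h3 : MeasurePreserving (fun zt : (ℝ ∙ n)ᗮ × ℝ => (zt.1 + zt.2 • w', zt.2))
      volume volume := by
    have := MeasurePreserving.skew_product (μa := (volume : Measure ℝ)) (μb := volume)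
      (μc := (volume : Measure (ℝ ∙ n)ᗮ)) (μd := volume) (f := id)
      (g := fun t z => z + t • w') (MeasurePreserving.id _) (by fun_prop)
      (Eventually.of_forall fun t => (measurePreserving_add_right volume (t • w')).map_eq)
    exact (Measure.measurePreserving_swap.comp this).comp Measure.measurePreserving_swap
  have h4 : MeasurePreserving (fun t : ℝ => c * t) (ENNReal.ofReal |c| • volume) volume := by
    refine ⟨by fun_prop, ?_⟩
    rw [Measure.map_smul, Real.smul_map_volume_mul_left hw]
  have h5 : MeasurePreserving (fun zt : (ℝ ∙ n)ᗮ × ℝ => (zt.1, c * zt.2))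
      (ENNReal.ofReal |c| • volume) volume := by
    have := (MeasurePreserving.id (volume : Measure (ℝ ∙ n)ᗮ)).prod h4
    rwa [Measure.prod_smul_right] at this
  have h3' := h3.smul_measure (ENNReal.ofReal |c|)
  -- As `w = w' + c • n`, the map is the shear by `w'`, then scaling of the normal coordinate by
  -- `c`, then the orthogonal parametrisation. Only the scaling changes the measure, by the factor
  -- |c|.
  convert (h2.comp h5).comp h3' using 1
  ext zt
  simp only [Function.comp_apply, w', Submodule.coe_add, Submodule.coe_smul, smul_sub, mul_smul,
    smul_comm c]
  abel

theorem integral_eq_hyperplane_slice {V : Type*} [NormedAddCommGroup V]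
    [InnerProductSpace ℝ V] [MeasurableSpace V] [BorelSpace V] [FiniteDimensional ℝ V]
    {n w : V} (hn : ‖n‖ = 1) (hw : inner ℝ w n ≠ 0) (q : V) {g : V → ℝ} (hg : Integrable g) :
    ∫ y, g y = |inner ℝ w n| * ∫ z : (ℝ ∙ n)ᗮ, ∫ t : ℝ, g (q + z + t • w) := by
  have h := measurePreserving_hyperplane_slice hn hw q
  have hc : ENNReal.ofReal |inner ℝ w n| ≠ 0 := by simpa using hw
  have hi : Integrable (fun zt : (ℝ ∙ n)ᗮ × ℝ => g (q + zt.1 + zt.2 • w)) := by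
    rw [← integrable_smul_measure hc (by simp)]
    exact h.integrable_comp_of_integrable hg
  have e : ∫ y, g y = |inner ℝ w n| * ∫ zt : (ℝ ∙ n)ᗮ × ℝ, g (q + zt.1 + zt.2 • w) := by
    rw [← h.map_eq, integral_map h.aemeasurable (by rw [h.map_eq]; exact hg.1),
      integral_smul_measure]
    simp
  rw [e, Measure.volume_eq_prod, integral_prod _ hi]


/-! ### Barycentric coordinates, normals and facets of a simplex -/

section Geometry

variable {d : ℕ}

theorem mem_closedInterior_iff_coord (K : Affine.Simplex ℝ (E d) d) {y : E d} :
    y ∈ K.closedInterior ↔ ∀ i, 0 ≤ (simplexBasis K).coord i y := by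
  rw [← K.convexHull_eq_closedInterior]
  exact Set.ext_iff.1 (simplexBasis K).convexHull_eq_nonneg_coord y

theorem affineCombination_simplexBasis_coord (K : Affine.Simplex ℝ (E d) d) (y : E d) :
    Finset.univ.affineCombination ℝ K.points (fun i => (simplexBasis K).coord i y) = y :=
  (simplexBasis K).affineCombination_coord_eq_self y

theorem mem_interior_iff_coord [NeZero d] (K : Affine.Simplex ℝ (E d) d) {y : E d} :
    y ∈ K.interior ↔ ∀ i, 0 < (simplexBasis K).coord i y := by
  have h1 : ∑ i, (simplexBasis K).coord i y = 1 := (simplexBasis K).sum_coord_apply_eq_one y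
  conv_lhs => rw [← affineCombination_simplexBasis_coord K y]
  rw [Affine.Simplex.affineCombination_mem_interior_iff h1]
  refine ⟨fun h i => (h i).1, fun h i => ⟨h i, ?_⟩⟩
  -- The open simplex also requires each coordinate to be below 1. This follows from positivity and
  -- total sum 1 once there are two vertices, that is d ≥ 1.
  have : Nontrivial (Fin (d + 1)) :=
    Fin.nontrivial_iff_two_le.2 (by have := NeZero.pos d; omega)
  obtain ⟨k, hk⟩ := exists_ne i
  rw [← h1]
  exact Finset.single_lt_sum hk (Finset.mem_univ _) (Finset.mem_univ _) (h k)
    fun t _ _ => (h t).le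

theorem interior_closedInterior [NeZero d] (K : Affine.Simplex ℝ (E d) d) :
    interior K.closedInterior = K.interior := by
  rw [← K.convexHull_eq_closedInterior]
  refine (simplexBasis K).interior_convexHull.trans ?_
  ext y
  exact (mem_interior_iff_coord K).symm

theorem isOpen_simplex_interior [NeZero d] (K : Affine.Simplex ℝ (E d) d) :
    IsOpen K.interior := by
  rw [← interior_closedInterior]; exact isOpen_interior

theorem mem_facet_iff_coord [NeZero d] (K : Affine.Simplex ℝ (E d) d) {j : Fin (d + 1)} {y : E d} :
    y ∈ facet K j ↔ y ∈ K.closedInterior ∧ (simplexBasis K).coord j y = 0 := by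
  have h1 : ∑ i, (simplexBasis K).coord i y = 1 := (simplexBasis K).sum_coord_apply_eq_one y
  rw [mem_closedInterior_iff_coord]
  conv_lhs => rw [← affineCombination_simplexBasis_coord K y]
  rw [facet, Affine.Simplex.faceOpposite,
    Affine.Simplex.affineCombination_mem_closedInterior_face_iff_nonneg K _ h1]
  simp only [Finset.mem_compl, Finset.mem_singleton, not_not, forall_eq]
  refine and_congr_left fun h0 => ⟨fun h i => ?_, fun h i _ => h i⟩
  by_cases hi : i = j
  · rw [hi, h0]
  · exact h i hi

theorem isCompact_facet [NeZero d] (K : Affine.Simplex ℝ (E d) d) (j : Fin (d + 1)) :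
    IsCompact (facet K j) := Affine.Simplex.isCompact_closedInterior _

theorem norm_outwardNormal [NeZero d] (K : Affine.Simplex ℝ (E d) d) (j : Fin (d + 1)) :
    ‖outwardNormal K j‖ = 1 := by
  rw [outwardNormal, norm_smul, norm_inv, norm_norm]
  exact inv_mul_cancel₀ (norm_ne_zero_iff.2 (sub_ne_zero.2 (K.ne_altitudeFoot j).symm))

theorem coord_altitudeFoot [NeZero d] (K : Affine.Simplex ℝ (E d) d) (j : Fin (d + 1)) :
    (simplexBasis K).coord j (K.altitudeFoot j) = 0 := by
  have h := K.altitudeFoot_mem_affineSpan_image_compl j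
  refine AffineMap.eqOn_affineSpan (g := AffineMap.const ℝ (E d) (0 : ℝ)) ?_ h
  rintro _ ⟨i, hi, rfl⟩
  exact ((simplexBasis K).coord_apply j i).trans (if_neg (Ne.symm hi))

/-- Two affine functions that agree on the vertices of a simplex are equal. -/
theorem affineMap_ext_points (K : Affine.Simplex ℝ (E d) d) {f g : E d →ᵃ[ℝ] ℝ}
    (h : ∀ i, f (K.points i) = g (K.points i)) : f = g := by
  ext y
  have hy : y ∈ affineSpan ℝ (Set.range K.points) := by
    rw [K.span_eq_top (by simp)]; trivial
  refine AffineMap.eqOn_affineSpan (f := f) (g := g) ?_ hy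
  rintro _ ⟨i, rfl⟩
  exact h i

/-- Both sides are affine in `y`, so the vertices decide: at vertex `j` both equal minus the height,
and at the others both vanish because the altitude is orthogonal to the facet. Thus a barycentric
coordinate is the signed distance to its facet divided by the height, which also shows that the
normal points outward. -/
theorem inner_sub_altitudeFoot_outwardNormal [NeZero d] (K : Affine.Simplex ℝ (E d) d)
    (j : Fin (d + 1)) (y : E d) :
    inner ℝ (y - K.altitudeFoot j) (outwardNormal K j) =
      -(K.height j * (simplexBasis K).coord j y) := by
  have hh : K.height j = ‖K.altitudeFoot j - K.points j‖ := by
    rw [Affine.Simplex.height, dist_comm, dist_eq_norm]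
  let f : E d →ᵃ[ℝ] ℝ :=
    (innerSL ℝ (outwardNormal K j)).toLinearMap.toAffineMap.comp
      (AffineMap.id ℝ (E d) - AffineMap.const ℝ (E d) (K.altitudeFoot j))
  let g : E d →ᵃ[ℝ] ℝ := -(K.height j • (simplexBasis K).coord j)
  suffices h : f = g by
    have := congrArg (fun φ : E d →ᵃ[ℝ] ℝ => φ y) h
    simpa [f, g, real_inner_comm] using this
  refine affineMap_ext_points K fun i => ?_
  have e : (simplexBasis K).coord j (K.points i) = if j = i then 1 else 0 :=
    (simplexBasis K).coord_apply j i
  have e1 : f (K.points i) = inner ℝ (outwardNormal K j) (K.points i - K.altitudeFoot j) := by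
    simp [f]
  have e2 : g (K.points i) = -(K.height j * if j = i then 1 else 0) := by
    simp [g, e]
  rw [e1, e2, outwardNormal, inner_smul_left]
  split_ifs with hji
  · subst hji
    rw [← neg_sub (K.altitudeFoot j) (K.points j), inner_neg_right, real_inner_self_eq_norm_sq, hh]
    have : ‖K.altitudeFoot j - K.points j‖ ≠ 0 :=
      norm_ne_zero_iff.2 (sub_ne_zero.2 (K.ne_altitudeFoot j).symm)
    simp only [conj_trivial]
    field_simp
  · have h0 : inner ℝ (K.points i - K.altitudeFoot j) (K.points j - K.altitudeFoot j) = 0 :=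
      K.inner_vsub_altitudeFoot_vsub_altitudeFoot_eq_zero (i := j) (j := i) hji
    rw [← neg_sub (K.points j), inner_neg_left, real_inner_comm, h0]
    simp

/-- In this form the normal components of an edge vector can be read off, since the coordinates
change at rate 1, -1 or 0 along an edge. -/
theorem inner_outwardNormal [NeZero d] (K : Affine.Simplex ℝ (E d) d)
    (j : Fin (d + 1)) (v : E d) :
    inner ℝ v (outwardNormal K j) = -(K.height j * ((simplexBasis K).coord j).linear v) := by
  have h := inner_sub_altitudeFoot_outwardNormal K j (v + K.altitudeFoot j)
  have e : (simplexBasis K).coord j (v + K.altitudeFoot j) =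
      ((simplexBasis K).coord j).linear v := by
    have := ((simplexBasis K).coord j).map_vadd (K.altitudeFoot j) v
    rw [vadd_eq_add, vadd_eq_add, coord_altitudeFoot, add_zero] at this
    exact this
  rwa [add_sub_cancel_right, e] at h

/-- The hyperplane through a facet, parametrised by its direction. -/
def facetPlane [NeZero d] (K : Affine.Simplex ℝ (E d) d) (j : Fin (d + 1))
    (z : (ℝ ∙ outwardNormal K j)ᗮ) : E d := K.altitudeFoot j + z

theorem isometry_facetPlane [NeZero d] (K : Affine.Simplex ℝ (E d) d) (j : Fin (d + 1)) :
    Isometry (facetPlane K j) :=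
  (isometry_add_left (K.altitudeFoot j)).comp isometry_subtype_coe

theorem coord_facetPlane [NeZero d] (K : Affine.Simplex ℝ (E d) d) (j : Fin (d + 1))
    (z : (ℝ ∙ outwardNormal K j)ᗮ) : (simplexBasis K).coord j (facetPlane K j z) = 0 := by
  have h := inner_sub_altitudeFoot_outwardNormal K j (facetPlane K j z)
  rw [facetPlane, add_sub_cancel_left,
    Submodule.mem_orthogonal_singleton_iff_inner_left.1 z.2] at h
  have := (K.height_pos j).ne'
  simpa [this, facetPlane] using h

theorem facet_subset_range_facetPlane [NeZero d] (K : Affine.Simplex ℝ (E d) d)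
    (j : Fin (d + 1)) : facet K j ⊆ Set.range (facetPlane K j) := by
  intro y hy
  refine ⟨⟨y - K.altitudeFoot j, ?_⟩, by simp [facetPlane]⟩
  rw [Submodule.mem_orthogonal_singleton_iff_inner_left,
    inner_sub_altitudeFoot_outwardNormal, ((mem_facet_iff_coord K).1 hy).2]
  simp

/-- Isometries preserve Hausdorff measure, and on the direction space of the hyperplane, of
dimension d - 1, the normalised Hausdorff measure is the volume. -/
theorem map_facetPlane_volume [NeZero d] (K : Affine.Simplex ℝ (E d) d) (j : Fin (d + 1)) :
    Measure.map (facetPlane K j) volume = μHE[d - 1].restrict (Set.range (facetPlane K j)) := by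
  have hn0 : outwardNormal K j ≠ 0 := by
    intro h; have := norm_outwardNormal K j; simp [h] at this
  have hV : finrank ℝ (ℝ ∙ outwardNormal K j)ᗮ = d - 1 := by
    have h := (ℝ ∙ outwardNormal K j).finrank_add_finrank_orthogonal
    rw [finrank_span_singleton hn0, finrank_euclideanSpace_fin] at h
    omega
  have hvol : (μHE[d - 1] : Measure (ℝ ∙ outwardNormal K j)ᗮ) = volume := by
    rw [← hV]; exact InnerProductSpace.euclideanHausdorffMeasure_eq_volume
  rw [← hvol, (isometry_facetPlane K j).map_euclideanHausdorffMeasure]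

/-- Surface integrals over a facet, in terms of the volume of the hyperplane through it. -/
theorem integral_facet [NeZero d] (K : Affine.Simplex ℝ (E d) d) (j : Fin (d + 1))
    (f : E d → ℝ) :
    ∫ y in facet K j, f y ∂μHE[d - 1] =
      ∫ z : (ℝ ∙ outwardNormal K j)ᗮ, (facet K j).indicator f (facetPlane K j z) := by
  have hF : MeasurableSet (facet K j) := (isCompact_facet K j).measurableSet
  rw [← (isometry_facetPlane K j).isClosedEmbedding.measurableEmbedding.integral_map,
    map_facetPlane_volume, integral_indicator hF, Measure.restrict_restrict hF,
    Set.inter_eq_self_of_subset_left (facet_subset_range_facetPlane K j)]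

theorem measure_facet_lt_top [NeZero d] (K : Affine.Simplex ℝ (E d) d) (j : Fin (d + 1)) :
    μHE[d - 1] (facet K j) < ⊤ := by
  have hF : MeasurableSet (facet K j) := (isCompact_facet K j).measurableSet
  have h : Measure.map (facetPlane K j) volume (facet K j) = μHE[d - 1] (facet K j) := by
    rw [map_facetPlane_volume, Measure.restrict_apply hF,
      Set.inter_eq_self_of_subset_left (facet_subset_range_facetPlane K j)]
  have hc := (isometry_facetPlane K j).isClosedEmbedding
  rw [← h, hc.measurableEmbedding.map_apply]
  exact (hc.isCompact_preimage (isCompact_facet K j)).measure_lt_top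

theorem integrableOn_facet [NeZero d] (K : Affine.Simplex ℝ (E d) d) (j : Fin (d + 1))
    {f : E d → ℝ} (hf : ContinuousOn f (facet K j)) :
    IntegrableOn f (facet K j) μHE[d - 1] := by
  obtain ⟨M, hM⟩ := (isCompact_facet K j).exists_bound_of_continuousOn hf
  have : IsFiniteMeasure (μHE[d - 1].restrict (facet K j)) :=
    isFiniteMeasure_restrict.2 (measure_facet_lt_top K j).ne
  exact Integrable.of_bound (hf.aestronglyMeasurable (isCompact_facet K j).measurableSet) M
    ((ae_restrict_iff' (isCompact_facet K j).measurableSet).2 (Eventually.of_forall hM))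

/-- Slicing the volume parallel to a facet. -/
theorem integral_eq_facetPlane_slice [NeZero d] (K : Affine.Simplex ℝ (E d) d) (j : Fin (d + 1))
    {v : E d} (hv : ((simplexBasis K).coord j).linear v ≠ 0) {g : E d → ℝ} (hg : Integrable g) :
    ∫ y, g y = K.height j * |((simplexBasis K).coord j).linear v| *
      ∫ z : (ℝ ∙ outwardNormal K j)ᗮ, ∫ t : ℝ, g (facetPlane K j z + t • v) := by
  have hj := K.height_pos j
  have h := inner_outwardNormal K j v
  rw [integral_eq_hyperplane_slice (norm_outwardNormal K j) (w := v)
    (by rw [h]; exact neg_ne_zero.2 (mul_ne_zero hj.ne' hv)) (K.altitudeFoot j) hg, h, abs_neg,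
    abs_mul, abs_of_pos hj]
  rfl

end Geometry


/-! ### The divergence theorem on a simplex -/

section Divergence

variable {d : ℕ}

theorem coord_add_smul (K : Affine.Simplex ℝ (E d) d) (i : Fin (d + 1)) (y v : E d) (t : ℝ) :
    (simplexBasis K).coord i (y + t • v) =
      (simplexBasis K).coord i y + t * ((simplexBasis K).coord i).linear v := by
  have := ((simplexBasis K).coord i).map_vadd y (t • v)
  rw [vadd_eq_add, vadd_eq_add, map_smul, smul_eq_mul] at this
  rw [add_comm y, this, add_comm]

theorem coord_points (K : Affine.Simplex ℝ (E d) d) (i j : Fin (d + 1)) :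
    (simplexBasis K).coord i (K.points j) = if i = j then 1 else 0 :=
  (simplexBasis K).coord_apply i j

theorem coord_linear_edge (K : Affine.Simplex ℝ (E d) d) (i a b : Fin (d + 1)) :
    ((simplexBasis K).coord i).linear (K.points a - K.points b) =
      (if i = a then 1 else 0) - if i = b then 1 else 0 := by
  rw [← coord_points, ← coord_points]
  exact ((simplexBasis K).coord i).linearMap_vsub _ _

theorem continuous_coord (K : Affine.Simplex ℝ (E d) d) (i : Fin (d + 1)) :
    Continuous ((simplexBasis K).coord i) :=
  continuous_barycentric_coord (simplexBasis K) i

theorem isCompact_cell (K : Affine.Simplex ℝ (E d) d) : IsCompact K.closedInterior :=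
  K.isCompact_closedInterior

variable [NeZero d]

/-- Integrating a directional derivative over a simplex along an edge. -/
theorem integral_fderiv_edge (K : Affine.Simplex ℝ (E d) d) {a b : Fin (d + 1)} (hab : a ≠ b)
    {f : E d → ℝ} (hf : ContDiff ℝ 1 f) :
    ∫ y in K.closedInterior, fderiv ℝ f y (K.points a - K.points b) =
      K.height a * ∫ y in facet K a,
        (f (y + (simplexBasis K).coord b y • (K.points a - K.points b)) - f y) ∂μHE[d - 1] := by
  set v := K.points a - K.points b with hv
  have hfd : Continuous (fun y => fderiv ℝ f y v) :=
    (hf.continuous_fderiv one_ne_zero).clm_apply continuous_const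
  have hK := (isCompact_cell K).measurableSet
  have hla : ((simplexBasis K).coord a).linear v = 1 := by
    rw [hv, coord_linear_edge]; simp [hab]
  have hlb : ((simplexBasis K).coord b).linear v = -1 := by
    rw [hv, coord_linear_edge]; simp [hab.symm]
  have hli : ∀ i, i ≠ a → i ≠ b → ((simplexBasis K).coord i).linear v = 0 := fun i h1 h2 => by
    rw [hv, coord_linear_edge]; simp [h1, h2]
  rw [← integral_indicator hK, integral_eq_facetPlane_slice K a (v := v) (by rw [hla]; simp)
    ((integrable_indicator_iff hK).2 (hfd.continuousOn.integrableOn_compact (isCompact_cell K))),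
    hla, abs_one, mul_one, integral_facet]
  congr 1
  refine integral_congr_ae (Eventually.of_forall fun z => ?_)
  set y := facetPlane K a z
  have hy : (simplexBasis K).coord a y = 0 := coord_facetPlane K a z
  -- Along `v` only two coordinates move: the one of `a` grows from 0 at rate 1 and the one of `b`
  -- decreases at rate 1. So the line leaves the simplex, through facet `b`, exactly when the latter
  -- is used up.
  have hmem : ∀ t : ℝ, y + t • v ∈ K.closedInterior ↔
      y ∈ facet K a ∧ t ∈ Set.Icc 0 ((simplexBasis K).coord b y) := by
    intro t
    rw [mem_facet_iff_coord, mem_closedInterior_iff_coord, mem_closedInterior_iff_coord]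
    simp only [coord_add_smul]
    constructor
    · intro h
      have h1 := h a
      have h2 := h b
      rw [hla, hy] at h1
      rw [hlb] at h2
      refine ⟨⟨fun i => ?_, hy⟩, by linarith, by linarith⟩
      by_cases hia : i = a
      · rw [hia, hy]
      by_cases hib : i = b
      · rw [hib]; linarith
      have h3 := h i
      rw [hli i hia hib] at h3
      linarith
    · rintro ⟨⟨h, -⟩, h1, h2⟩ i
      by_cases hia : i = a
      · rw [hia, hy, hla]; linarith
      by_cases hib : i = b
      · rw [hib, hlb]; linarith
      rw [hli i hia hib]
      linarith [h i]
  by_cases hF : y ∈ facet K a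
  · have hb0 : 0 ≤ (simplexBasis K).coord b y :=
      (mem_closedInterior_iff_coord K).1 ((mem_facet_iff_coord K).1 hF).1 b
    have e : (fun t : ℝ => K.closedInterior.indicator (fun y => fderiv ℝ f y v) (y + t • v)) =
        (Set.Icc 0 ((simplexBasis K).coord b y)).indicator
          (fun t => fderiv ℝ f (y + t • v) v) := by
      ext t
      by_cases ht : t ∈ Set.Icc 0 ((simplexBasis K).coord b y)
      · rw [Set.indicator_of_mem ht, Set.indicator_of_mem ((hmem t).2 ⟨hF, ht⟩)]
      · rw [Set.indicator_of_notMem ht, Set.indicator_of_notMem fun h => ht ((hmem t).1 h).2]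
    have hd : ∀ t : ℝ, HasDerivAt (fun t : ℝ => f (y + t • v)) (fderiv ℝ f (y + t • v) v) t := by
      intro t
      have h1 : HasDerivAt (fun t : ℝ => y + t • v) v t := by
        simpa using ((hasDerivAt_id t).smul_const v).const_add y
      exact ((hf.differentiable one_ne_zero) _).hasFDerivAt.comp_hasDerivAt t h1
    simp only
    rw [e, integral_indicator measurableSet_Icc, integral_Icc_eq_integral_Ioc,
      ← intervalIntegral.integral_of_le hb0,
      intervalIntegral.integral_eq_sub_of_hasDerivAt (fun t _ => hd t)
        ((hfd.comp (by fun_prop : Continuous fun t : ℝ => y + t • v)).intervalIntegrable _ _),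
      Set.indicator_of_mem hF]
    simp
  · simp only
    rw [Set.indicator_of_notMem hF]
    exact (integral_congr_ae (Eventually.of_forall fun t =>
      Set.indicator_of_notMem (fun h => hF ((hmem t).1 h).1) _)).trans (integral_zero _ _)

/-- Parallel projection along an edge scales the surface measure by the ratio of the heights. -/
theorem integral_facet_projection (K : Affine.Simplex ℝ (E d) d) {a b : Fin (d + 1)} (hab : a ≠ b)
    {f : E d → ℝ} (hf : Continuous f) :
    K.height a * ∫ y in facet K a,
        f (y + (simplexBasis K).coord b y • (K.points a - K.points b)) ∂μHE[d - 1] =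
      K.height b * ∫ y in facet K b, f y ∂μHE[d - 1] := by
  set v := K.points a - K.points b with hv
  have hla : ((simplexBasis K).coord a).linear v = 1 := by
    rw [hv, coord_linear_edge]; simp [hab]
  have hlb : ((simplexBasis K).coord b).linear v = -1 := by
    rw [hv, coord_linear_edge]; simp [hab.symm]
  have hli : ∀ i, i ≠ a → i ≠ b → ((simplexBasis K).coord i).linear v = 0 := fun i h1 h2 => by
    rw [hv, coord_linear_edge]; simp [h1, h2]
  let π : E d → E d := fun y => y + (simplexBasis K).coord b y • v
  have hπ : Continuous π := by
    have := continuous_coord K b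
    fun_prop
  -- An oblique prism over facet `b`, whose sections in direction `v` have parameter length 1.
  -- Slicing the integral of `f ∘ π` over it parallel to facet `a` and parallel to facet `b`
  -- produces the two sides, so no Jacobian of the projection is computed.
  let P : Set (E d) := {y | (simplexBasis K).coord b y ∈ Set.Icc 0 1 ∧ π y ∈ facet K b}
  have hPc : IsCompact P := by
    have h1 : IsClosed P := (isClosed_Icc.preimage (continuous_coord K b)).inter
      ((isCompact_facet K b).isClosed.preimage hπ)
    have h2 : IsCompact ((fun p : E d × ℝ => p.1 - p.2 • v) '' (facet K b ×ˢ Set.Icc 0 1)) :=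
      ((isCompact_facet K b).prod isCompact_Icc).image (by fun_prop)
    refine h2.of_isClosed_subset h1 ?_
    rintro y ⟨hy1, hy2⟩
    exact ⟨(π y, (simplexBasis K).coord b y), ⟨hy2, hy1⟩, by simp [π]⟩
  have hint : Integrable (P.indicator (f ∘ π)) :=
    (integrable_indicator_iff hPc.measurableSet).2
      ((hf.comp hπ).continuousOn.integrableOn_compact hPc)
  have hline : ∀ y, ∫ t : ℝ, P.indicator (f ∘ π) (y + t • v) = (facet K b).indicator f (π y) := by
    intro y
    have hπt : ∀ t : ℝ, π (y + t • v) = π y := by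
      intro t
      simp only [π, coord_add_smul, hlb]
      module
    by_cases hF : π y ∈ facet K b
    · have e : (fun t : ℝ => P.indicator (f ∘ π) (y + t • v)) =
          (Set.Icc ((simplexBasis K).coord b y - 1) ((simplexBasis K).coord b y)).indicator
            (fun _ => f (π y)) := by
        ext t
        have hm : y + t • v ∈ P ↔
            t ∈ Set.Icc ((simplexBasis K).coord b y - 1) ((simplexBasis K).coord b y) := by
          simp only [P, Set.mem_ofPred_eq, hπt, hF, and_true, coord_add_smul, hlb, Set.mem_Icc]
          constructor <;> rintro ⟨h1, h2⟩ <;> constructor <;> linarith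
        by_cases ht : y + t • v ∈ P
        · rw [Set.indicator_of_mem ht, Set.indicator_of_mem (hm.1 ht), Function.comp_apply, hπt]
        · rw [Set.indicator_of_notMem ht, Set.indicator_of_notMem fun h => ht (hm.2 h)]
      rw [e, integral_indicator measurableSet_Icc, Set.indicator_of_mem hF]
      simp
    · rw [Set.indicator_of_notMem hF]
      have : ∀ t : ℝ, y + t • v ∉ P := fun t h => hF (by rw [← hπt t]; exact h.2)
      simp [Set.indicator_of_notMem, this]
  have ha := integral_eq_facetPlane_slice K a (v := v) (by rw [hla]; simp) hint
  have hb := integral_eq_facetPlane_slice K b (v := v) (by rw [hlb]; simp) hint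
  simp only [hline, hla, hlb, abs_neg, abs_one, mul_one] at ha hb
  rw [integral_facet, integral_facet]
  have ea : ∀ z, (facet K b).indicator f (π (facetPlane K a z)) =
      (facet K a).indicator (fun y => f (y + (simplexBasis K).coord b y • v))
        (facetPlane K a z) := by
    intro z
    set y := facetPlane K a z
    have hy : (simplexBasis K).coord a y = 0 := coord_facetPlane K a z
    have hm : π y ∈ facet K b ↔ y ∈ facet K a := by
      simp only [mem_facet_iff_coord, mem_closedInterior_iff_coord, π, coord_add_smul, hlb, hy,
        and_true, mul_neg, mul_one, add_neg_cancel]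
      constructor
      · intro h i
        by_cases hia : i = a
        · rw [hia, hy]
        by_cases hib : i = b
        · have := h a
          rw [hla, hy] at this
          rw [hib]; linarith
        have h3 := h i
        rw [hli i hia hib] at h3
        linarith
      · intro h i
        by_cases hia : i = a
        · rw [hia, hy, hla]; linarith [h b]
        by_cases hib : i = b
        · rw [hib, hlb]; linarith
        rw [hli i hia hib]
        linarith [h i]
    by_cases h : y ∈ facet K a
    · rw [Set.indicator_of_mem h, Set.indicator_of_mem (hm.2 h)]
    · rw [Set.indicator_of_notMem h, Set.indicator_of_notMem fun h' => h (hm.1 h')]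
  have eb : ∀ z, π (facetPlane K b z) = facetPlane K b z := by
    intro z
    simp [π, coord_facetPlane]
  simp only [ea] at ha
  simp only [eb] at hb
  rw [← ha, hb]

theorem integral_fderiv_edge_eq_sub (K : Affine.Simplex ℝ (E d) d) (a b : Fin (d + 1))
    {f : E d → ℝ} (hf : ContDiff ℝ 1 f) :
    ∫ y in K.closedInterior, fderiv ℝ f y (K.points a - K.points b) =
      K.height b * ∫ y in facet K b, f y ∂μHE[d - 1] -
        K.height a * ∫ y in facet K a, f y ∂μHE[d - 1] := by
  by_cases hab : a = b
  · simp [hab]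
  have h1 : Continuous fun y => f (y + (simplexBasis K).coord b y • (K.points a - K.points b)) := by
    have := continuous_coord K b
    have := hf.continuous
    fun_prop
  rw [integral_fderiv_edge K hab hf, integral_sub (integrableOn_facet K a h1.continuousOn)
    (integrableOn_facet K a hf.continuous.continuousOn), mul_sub,
    integral_facet_projection K hab hf.continuous]

/-- **Divergence theorem** on a simplex, for a vector field of constant direction. -/
theorem integral_fderiv_simplex (K : Affine.Simplex ℝ (E d) d)
    {f : E d → ℝ} (hf : ContDiff ℝ 1 f) (v : E d) :
    ∫ y in K.closedInterior, fderiv ℝ f y v =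
      ∑ j, inner ℝ v (outwardNormal K j) * ∫ y in facet K j, f y ∂μHE[d - 1] := by
  have hfd : ∀ v, IntegrableOn (fun y => fderiv ℝ f y v) K.closedInterior := fun v =>
    ((hf.continuous_fderiv one_ne_zero).clm_apply continuous_const).continuousOn.integrableOn_compact
      (isCompact_cell K)
  let A : E d →ₗ[ℝ] ℝ :=
    { toFun := fun v => ∫ y in K.closedInterior, fderiv ℝ f y v
      map_add' := fun v w => by
        simp only [map_add]; exact integral_add (hfd v) (hfd w)
      map_smul' := fun c v => by
        simp only [map_smul, smul_eq_mul, RingHom.id_apply]; exact integral_const_mul _ _ }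
  let B : E d →ₗ[ℝ] ℝ :=
    { toFun := fun v => ∑ j, inner ℝ v (outwardNormal K j) * ∫ y in facet K j, f y ∂μHE[d - 1]
      map_add' := fun v w => by
        simp only [inner_add_left, add_mul, Finset.sum_add_distrib]
      map_smul' := fun c v => by
        simp only [inner_smul_left, conj_trivial, RingHom.id_apply, smul_eq_mul, Finset.mul_sum,
          mul_assoc] }
  suffices h : A = B from congrArg (fun φ : E d →ₗ[ℝ] ℝ => φ v) h
  -- Both sides are linear in the direction, so the edges from vertex 0, which form a basis,
  -- suffice. For such an edge only the facets opposite to its two ends contribute.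
  refine ((simplexBasis K).basisOf 0).ext fun i => ?_
  have hi : (simplexBasis K).basisOf 0 i = K.points i - K.points 0 := by
    rw [AffineBasis.basisOf_apply]; rfl
  rw [hi]
  have hA : A (K.points i - K.points 0) = _ := integral_fderiv_edge_eq_sub K i 0 hf
  have hB : B (K.points i - K.points 0) = ∑ j, inner ℝ (K.points i - K.points 0)
    (outwardNormal K j) * ∫ y in facet K j, f y ∂μHE[d - 1] := rfl
  rw [hA, hB]
  simp only [inner_outwardNormal, coord_linear_edge]
  simp only [mul_sub, neg_sub, sub_mul, mul_ite, mul_one, mul_zero, ite_mul, zero_mul,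
    Finset.sum_sub_distrib, Finset.sum_ite_eq', Finset.mem_univ, if_true]

end Divergence


/-! ### Divergence identities for radial fields -/

section Radial

/-- A `C^1` function on `(0, ∞)` agrees away from `0` with a `C^1` function on the line. -/
theorem exists_contDiff_eqOn_Ioi {G : ℝ → ℝ} (hG : ∀ t, 0 < t → ContDiffAt ℝ 1 G t) {δ : ℝ}
    (hδ : 0 < δ) : ∃ H : ℝ → ℝ, ContDiff ℝ 1 H ∧ ∀ t, δ < t → H t = G t := by
  -- The cutoff is 0 for t ≤ δ/2 and 1 for t ≥ δ, so the behaviour of `G` at 0 and on the negative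
  -- axis is irrelevant.
  refine ⟨fun t => Real.smoothTransition (2 * t / δ - 1) * G t, ?_, fun t ht => ?_⟩
  · rw [contDiff_iff_contDiffAt]
    intro t
    by_cases ht : 0 < t
    · have h1 : ContDiff ℝ 1 fun t : ℝ => Real.smoothTransition (2 * t / δ - 1) :=
        Real.smoothTransition.contDiff.comp (by fun_prop)
      exact h1.contDiffAt.mul (hG t ht)
    · have h2 : (fun t => Real.smoothTransition (2 * t / δ - 1) * G t) =ᶠ[𝓝 t] fun _ => 0 := by
        have : ∀ᶠ r in 𝓝 t, r < δ / 2 := eventually_lt_nhds (by linarith)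
        filter_upwards [this] with r hr
        rw [Real.smoothTransition.zero_of_nonpos, zero_mul]
        rw [sub_nonpos, div_le_one hδ]
        linarith
      exact contDiffAt_const.congr_of_eventuallyEq h2
  · simp only
    rw [Real.smoothTransition.one_of_one_le, one_mul]
    rw [le_sub_iff_add_le, le_div_iff₀ hδ]
    linarith

variable {d : ℕ}

/-- Profiles are functions of the squared distance because this is smooth also at `x`. -/
theorem contDiff_comp_normSq {H : ℝ → ℝ} (hH : ContDiff ℝ 1 H) (x : E d) :
    ContDiff ℝ 1 fun y : E d => H (‖y - x‖ ^ 2) :=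
  hH.comp ((contDiff_id.sub contDiff_const).norm_sq ℝ)

theorem hasFDerivAt_comp_normSq {H : ℝ → ℝ} (hH : ContDiff ℝ 1 H) (x y : E d) :
    HasFDerivAt (fun y : E d => H (‖y - x‖ ^ 2))
      ((deriv H (‖y - x‖ ^ 2) * 2) • innerSL ℝ (y - x)) y := by
  have h1 : HasFDerivAt (fun y : E d => ‖y - x‖ ^ 2) (2 • innerSL ℝ (y - x)) y := by
    have := ((hasFDerivAt_id (𝕜 := ℝ) y).sub_const x).norm_sq
    simpa using this
  have h2 := ((hH.differentiable one_ne_zero) (‖y - x‖ ^ 2)).hasDerivAt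
  refine (h2.comp_hasFDerivAt y h1).congr_fderiv ?_
  ext v
  simp [mul_assoc]

variable [NeZero d]

/-- The divergence theorem for the field H(|y - x|²) a. With H a primitive of the kernel profile it
evaluates the integral of a·(y - x) against the kernel. -/
theorem integral_simplex_gradient_radial (K : Affine.Simplex ℝ (E d) d) {H : ℝ → ℝ}
    (hH : ContDiff ℝ 1 H) (x a : E d) :
    ∫ y in K.closedInterior, 2 * deriv H (‖y - x‖ ^ 2) * inner ℝ a (y - x) =
      ∑ j, inner ℝ a (outwardNormal K j) * ∫ y in facet K j, H (‖y - x‖ ^ 2) ∂μHE[d - 1] := by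
  rw [← integral_fderiv_simplex K (contDiff_comp_normSq hH x) a]
  congr 1
  ext y
  rw [(hasFDerivAt_comp_normSq hH x y).fderiv]
  simp only [smul_apply, innerSL_apply_apply, smul_eq_mul]
  rw [real_inner_comm, mul_comm (2 : ℝ)]

/-- The divergence theorem for the field (c + a·(y - x)) H(|y - x|²) (y - x), obtained by summing
the constant-direction version over its Cartesian components. -/
theorem integral_simplex_div_radial (K : Affine.Simplex ℝ (E d) d) {H : ℝ → ℝ}
    (hH : ContDiff ℝ 1 H) (x a : E d) (c : ℝ) :
    ∫ y in K.closedInterior, ((c + inner ℝ a (y - x)) *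
        (d * H (‖y - x‖ ^ 2) + 2 * ‖y - x‖ ^ 2 * deriv H (‖y - x‖ ^ 2)) +
        H (‖y - x‖ ^ 2) * inner ℝ a (y - x)) =
      ∑ j, ∫ y in facet K j, (c + inner ℝ a (y - x)) * H (‖y - x‖ ^ 2) *
        inner ℝ (y - x) (outwardNormal K j) ∂μHE[d - 1] := by
  let e : Fin d → E d := fun i => EuclideanSpace.single i 1
  let f : Fin d → E d → ℝ := fun i y => (c + inner ℝ a (y - x)) * H (‖y - x‖ ^ 2) * (y - x) i
  have hcoord : ∀ i, ContDiff ℝ 1 fun y : E d => (y - x) i := fun i =>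
    (EuclideanSpace.proj (𝕜 := ℝ) i).contDiff.comp (contDiff_id.sub contDiff_const)
  have haff : ContDiff ℝ 1 fun y : E d => c + inner ℝ a (y - x) :=
    contDiff_const.add (contDiff_const.inner ℝ (contDiff_id.sub contDiff_const))
  have hf : ∀ i, ContDiff ℝ 1 (f i) := fun i => (haff.mul (contDiff_comp_normSq hH x)).mul (hcoord i)
  have hfd : ∀ i y, fderiv ℝ (f i) y (e i) = a i * (y - x) i * H (‖y - x‖ ^ 2) +
      (c + inner ℝ a (y - x)) * (2 * deriv H (‖y - x‖ ^ 2) * ((y - x) i * (y - x) i) +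
        H (‖y - x‖ ^ 2)) := by
    intro i y
    have h1 : HasFDerivAt (fun y : E d => (y - x) i) (EuclideanSpace.proj (𝕜 := ℝ) i) y := by
      have := (EuclideanSpace.proj i : E d →L[ℝ] ℝ).hasFDerivAt (x := y - x)
      exact this.comp y ((hasFDerivAt_id y).sub_const x)
    have h2 : HasFDerivAt (fun y : E d => c + inner ℝ a (y - x)) (innerSL ℝ a) y := by
      have := ((innerSL ℝ a).hasFDerivAt (x := y - x)).comp y ((hasFDerivAt_id y).sub_const x)
      exact this.const_add c
    have h3 := (h2.mul (hasFDerivAt_comp_normSq hH x y)).mul h1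
    have h4 : HasFDerivAt (f i) _ y := h3
    rw [h4.fderiv]
    simp [e, EuclideanSpace.inner_single_right]
    ring
  have hint : ∀ i, IntegrableOn (fun y => fderiv ℝ (f i) y (e i)) K.closedInterior := fun i =>
    (((hf i).continuous_fderiv one_ne_zero).clm_apply
      continuous_const).continuousOn.integrableOn_compact (isCompact_cell K)
  have hsum : ∀ y, (c + inner ℝ a (y - x)) *
        (d * H (‖y - x‖ ^ 2) + 2 * ‖y - x‖ ^ 2 * deriv H (‖y - x‖ ^ 2)) +
        H (‖y - x‖ ^ 2) * inner ℝ a (y - x) = ∑ i, fderiv ℝ (f i) y (e i) := by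
    intro y
    have hi : inner ℝ a (y - x) = ∑ i, a i * (y - x) i := by
      simp [PiLp.inner_apply, mul_comm]
    have hn : ‖y - x‖ ^ 2 = ∑ i, (y - x) i * (y - x) i := by
      rw [EuclideanSpace.real_norm_sq_eq]; simp [sq]
    simp only [hfd, Finset.sum_add_distrib, ← Finset.sum_mul, ← Finset.mul_sum, ← hi, ← hn]
    simp
    ring
  simp only [hsum]
  rw [integral_finsetSum _ fun i _ => hint i]
  simp only [integral_fderiv_simplex K (hf _)]
  rw [Finset.sum_comm]
  refine Finset.sum_congr rfl fun j _ => ?_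
  simp only [← integral_const_mul]
  rw [← integral_finsetSum _ fun i _ =>
    integrableOn_facet K j ((hf i).continuous.const_mul _).continuousOn]
  congr 1
  ext y
  have hi : inner ℝ (y - x) (outwardNormal K j) = ∑ i, (y - x) i * outwardNormal K j i := by
    simp [PiLp.inner_apply, mul_comm]
  rw [hi, Finset.mul_sum]
  refine Finset.sum_congr rfl fun i _ => ?_
  simp only [f, e, EuclideanSpace.inner_single_left]
  simp
  ring

/-- The integral of the divergence of a rapidly decaying radial field vanishes. -/
theorem integral_div_radial_eq_zero {H : ℝ → ℝ} (hH : ContDiff ℝ 1 H) {s δ : ℝ} (hs : 0 < s)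
    (hHδ : ∀ t, δ < t → H t = t ^ (-((d + 2 * s) / 2))) (x : E d) :
    ∫ y : E d, ((d : ℝ) * H (‖y - x‖ ^ 2) + 2 * ‖y - x‖ ^ 2 * deriv H (‖y - x‖ ^ 2)) = 0 := by
  rw [integral_sub_right_eq_self (μ := (volume : Measure (E d)))
    (fun y : E d => ((d : ℝ) * H (‖y‖ ^ 2) + 2 * ‖y‖ ^ 2 * deriv H (‖y‖ ^ 2))) x]
  rw [integral_fun_norm_addHaar volume
    (fun r : ℝ => (d : ℝ) * H (r ^ 2) + 2 * r ^ 2 * deriv H (r ^ 2))]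
  have hd := NeZero.pos d
  suffices h : ∫ r in Set.Ioi (0 : ℝ), r ^ (finrank ℝ (E d) - 1) •
      ((d : ℝ) * H (r ^ 2) + 2 * r ^ 2 * deriv H (r ^ 2)) = 0 by rw [h]; simp
  rw [finrank_euclideanSpace_fin]
  -- In polar coordinates the integrand is the derivative of r^d H(r²), which vanishes at 0 since d
  -- ≥ 1 and equals r^(-2s) for large r. Integrability need not be proved: in the other case the
  -- integral is 0 by convention.
  by_cases hI : IntegrableOn (fun r : ℝ => r ^ (d - 1) •
      ((d : ℝ) * H (r ^ 2) + 2 * r ^ 2 * deriv H (r ^ 2))) (Set.Ioi 0)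
  · have hderiv : ∀ r : ℝ, HasDerivAt (fun r => r ^ d * H (r ^ 2)) (r ^ (d - 1) •
        ((d : ℝ) * H (r ^ 2) + 2 * r ^ 2 * deriv H (r ^ 2))) r := by
      intro r
      have h1 := ((hH.differentiable one_ne_zero) (r ^ 2)).hasDerivAt.comp r (hasDerivAt_pow 2 r)
      refine ((hasDerivAt_pow d r).mul h1).congr_deriv ?_
      obtain ⟨m, rfl⟩ : ∃ m, d = m + 1 := ⟨d - 1, by omega⟩
      simp only [Function.comp_apply, add_tsub_cancel_right, smul_eq_mul]
      push_cast
      ring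
    have hlim : Tendsto (fun r : ℝ => r ^ d * H (r ^ 2)) atTop (𝓝 0) := by
      have h1 : Tendsto (fun r : ℝ => r ^ (-(2 * s))) atTop (𝓝 0) :=
        tendsto_rpow_neg_atTop (by linarith)
      refine h1.congr' ?_
      filter_upwards [eventually_gt_atTop (max 1 δ)] with r hr
      have hr1 : 1 < r := (le_max_left _ _).trans_lt hr
      have hr0 : 0 < r := by linarith
      have hrδ : δ < r ^ 2 := by
        have := (le_max_right 1 δ).trans_lt hr
        nlinarith
      rw [hHδ _ hrδ, ← Real.rpow_natCast r d, ← Real.rpow_natCast r 2, ← Real.rpow_mul hr0.le,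
        ← Real.rpow_add hr0]
      congr 1
      push_cast
      ring
    rw [integral_Ioi_of_hasDerivAt_of_tendsto' (fun r _ => hderiv r) hI hlim]
    simp [hd.ne']
  · exact integral_undef hI

end Radial


/-! ### Integrals of the kernel over elements and complements -/

section Kernel

variable {d : ℕ}

/-- The kernel `|x - y|^(-d-2s)`. -/
def kernel (s : ℝ) (x y : E d) : ℝ := (‖y - x‖ ^ 2) ^ (-(((d : ℝ) + 2 * s) / 2))

theorem rpow_normSq (x y : E d) (r : ℝ) : (‖y - x‖ ^ 2) ^ r = ‖x - y‖ ^ (2 * r) := by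
  rw [← Real.rpow_natCast, ← Real.rpow_mul (norm_nonneg _), norm_sub_rev]
  norm_num

theorem kernel_eq (s : ℝ) (x y : E d) : kernel s x y = (‖x - y‖ ^ ((d : ℝ) + 2 * s))⁻¹ := by
  rw [kernel, rpow_normSq, ← Real.rpow_neg (norm_nonneg _)]
  congr 1
  ring

theorem continuousOn_kernel (s : ℝ) (x : E d) : ContinuousOn (kernel s x) {x}ᶜ := by
  refine ContinuousOn.rpow_const (by fun_prop) fun y hy => Or.inl ?_
  have : y - x ≠ 0 := sub_ne_zero.2 hy
  positivity

theorem integrableOn_kernel_compl_ball [NeZero d] {s : ℝ} (hs : 0 < s) (x : E d) {ε : ℝ}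
    (hε : 0 < ε) : IntegrableOn (kernel s x) (Metric.ball x ε)ᶜ := by
  have hr : (finrank ℝ (E d) : ℝ) < (d : ℝ) + 2 * s := by
    rw [finrank_euclideanSpace_fin]; linarith
  have h0 : 0 ≤ (d : ℝ) + 2 * s := by positivity
  have h1 := ((integrable_one_add_norm (μ := (volume : Measure (E d))) hr).comp_sub_right x).const_mul
    ((1 / ε + 1) ^ ((d : ℝ) + 2 * s))
  have hm : MeasurableSet (Metric.ball x ε)ᶜ := measurableSet_ball.compl
  refine Integrable.mono' h1.integrableOn ?_ ?_
  · refine ((continuousOn_kernel s x).mono ?_).aestronglyMeasurable hm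
    rintro y hy rfl
    exact hy (Metric.mem_ball_self hε)
  · refine (ae_restrict_iff' hm).2 (Eventually.of_forall fun y hy => ?_)
    have hy : ε ≤ ‖y - x‖ := by
      simpa [dist_eq_norm] using hy
    have hpos : 0 < ‖y - x‖ := hε.trans_le hy
    rw [kernel_eq, norm_sub_rev x y, Real.norm_of_nonneg (by positivity),
      Real.rpow_neg (by positivity), ← div_eq_mul_inv, ← one_div,
      div_le_div_iff₀ (by positivity) (by positivity), one_mul,
      ← Real.mul_rpow (by positivity) (by positivity)]
    refine Real.rpow_le_rpow (by positivity) ?_ h0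
    have : 1 ≤ 1 / ε * ‖y - x‖ := by
      rw [one_div, inv_mul_eq_div, le_div_iff₀ hε]; linarith
    linarith

/-- The last clause is Euler's identity for the homogeneity degree -d-2s: the divergence of the
kernel times y - x carries the factor d - (d + 2s) = -2s. -/
theorem exists_truncation_kernel (d : ℕ) (s : ℝ) {δ : ℝ} (hδ : 0 < δ) :
    ∃ H : ℝ → ℝ, ContDiff ℝ 1 H ∧ (∀ t, δ < t → H t = t ^ (-(((d : ℝ) + 2 * s) / 2))) ∧
      ∀ t, δ < t → d * H t + 2 * t * deriv H t =
        -(2 * s) * t ^ (-(((d : ℝ) + 2 * s) / 2)) := by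
  obtain ⟨H, hH, hHδ⟩ := exists_contDiff_eqOn_Ioi
    (G := fun t => t ^ (-(((d : ℝ) + 2 * s) / 2)))
    (fun t ht => Real.contDiffAt_rpow_const_of_ne ht.ne') hδ
  refine ⟨H, hH, hHδ, fun t ht => ?_⟩
  have ht0 : 0 < t := hδ.trans ht
  have h1 : H =ᶠ[𝓝 t] fun t => t ^ (-(((d : ℝ) + 2 * s) / 2)) :=
    (eventually_gt_nhds ht).mono hHδ
  rw [h1.deriv_eq, hHδ t ht, (Real.hasDerivAt_rpow_const (Or.inl ht0.ne')).deriv,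
    Real.rpow_sub_one ht0.ne']
  field_simp
  ring

theorem exists_truncation_primitive {G g : ℝ → ℝ} (hG1 : ∀ t, 0 < t → ContDiffAt ℝ 1 G t)
    (hG : ∀ t, 0 < t → HasDerivAt G (g t) t) {δ : ℝ} (hδ : 0 < δ) :
    ∃ H : ℝ → ℝ, ContDiff ℝ 1 H ∧ (∀ t, δ < t → H t = G t) ∧ ∀ t, δ < t → deriv H t = g t := by
  obtain ⟨H, hH, hHδ⟩ := exists_contDiff_eqOn_Ioi hG1 hδ
  refine ⟨H, hH, hHδ, fun t ht => ?_⟩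
  have h1 : H =ᶠ[𝓝 t] G := (eventually_gt_nhds ht).mono hHδ
  rw [h1.deriv_eq, (hG t (hδ.trans ht)).deriv]

/-- The reflection of the space in `x` preserves the ball and the volume and changes the sign of
`h`. This is the cancellation behind the principal value. -/
theorem integral_ball_eq_zero_of_odd (x : E d) (ε : ℝ) {h : E d → ℝ}
    (hodd : ∀ z, h (x - z) = -h (x + z)) : ∫ y in Metric.ball x ε, h y = 0 := by
  rw [← integral_indicator measurableSet_ball]
  set f := (Metric.ball x ε).indicator h
  have h1 : ∀ y, f (x + x - y) = -f y := by
    intro y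
    have e : x + x - y = x - (y - x) := by abel
    have e2 : h (x + x - y) = -h y := by rw [e, hodd, add_sub_cancel]
    have hm : x + x - y ∈ Metric.ball x ε ↔ y ∈ Metric.ball x ε := by
      rw [mem_ball_iff_norm, mem_ball_iff_norm, e, sub_sub_cancel_left, norm_neg]
    by_cases hy : y ∈ Metric.ball x ε
    · simp only [f]
      rw [Set.indicator_of_mem (hm.2 hy), Set.indicator_of_mem hy, e2]
    · simp only [f]
      rw [Set.indicator_of_notMem fun h' => hy (hm.1 h'), Set.indicator_of_notMem hy, neg_zero]
  have h2 := integral_sub_left_eq_self f volume (x + x)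
  simp only [h1] at h2
  rw [integral_neg] at h2
  linarith

variable [NeZero d] {s : ℝ} {G : ℝ → ℝ}

/-- The integral of an affine function against the kernel over an element away from `x`. -/
theorem integral_cell_affine_mul_kernel (K : Affine.Simplex ℝ (E d) d) (hs : 0 < s)
    (hG1 : ∀ t, 0 < t → ContDiffAt ℝ 1 G t)
    (hG : ∀ t, 0 < t → HasDerivAt G (-t ^ (-(((d : ℝ) + 2 * s) / 2))) t)
    {x : E d} (hx : x ∉ K.closedInterior) (c : ℝ) (a : E d) :
    ∫ y in K.closedInterior, (c + inner ℝ a (y - x)) * kernel s x y =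
      -(1 / (2 * s)) * ((∑ j, ∫ y in facet K j, (c + inner ℝ a (y - x)) * kernel s x y *
        inner ℝ (y - x) (outwardNormal K j) ∂μHE[d - 1]) + 1 / 2 *
        ∑ j, inner ℝ a (outwardNormal K j) * ∫ y in facet K j, G (‖y - x‖ ^ 2) ∂μHE[d - 1]) := by
  obtain ⟨ε, hε, hball⟩ := Metric.isOpen_iff.1 (isCompact_cell K).isClosed.isOpen_compl x hx
  have hfar : ∀ y ∈ K.closedInterior, ε ^ 2 / 2 < ‖y - x‖ ^ 2 := by
    intro y hy
    have h1 : ε ≤ ‖y - x‖ := by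
      by_contra! h
      exact hball (mem_ball_iff_norm.2 h) hy
    nlinarith
  have hfacet : ∀ j, ∀ y ∈ facet K j, ε ^ 2 / 2 < ‖y - x‖ ^ 2 := fun j y hy =>
    hfar y ((mem_facet_iff_coord K).1 hy).1
  have hK := (isCompact_cell K).measurableSet
  have hF := fun j => (isCompact_facet K j).measurableSet
  -- Points of the element have squared distance at least ε² from `x`. The truncation is exact only
  -- strictly above its threshold, hence a threshold smaller than ε².
  obtain ⟨P, hP, hP1, hP2⟩ := exists_truncation_kernel d s (δ := ε ^ 2 / 2) (by positivity)
  obtain ⟨H, hH, hH1, hH2⟩ := exists_truncation_primitive hG1 hG (δ := ε ^ 2 / 2) (by positivity)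
  have hker : ContinuousOn (kernel s x) K.closedInterior :=
    (continuousOn_kernel s x).mono fun y hy h => hx (h ▸ hy)
  -- `e2` will express -2s times the wanted integral plus the integral of a·(y - x) against the
  -- kernel; `e1` eliminates the latter.
  have e1 := integral_simplex_gradient_radial K hH x a
  have e2 := integral_simplex_div_radial K hP x a c
  rw [setIntegral_congr_fun (g := fun y => -2 * (inner ℝ a (y - x) * kernel s x y)) hK
    (fun y hy => by simp only [hH2 _ (hfar y hy), kernel]; ring), integral_const_mul] at e1
  rw [setIntegral_congr_fun (g := fun y => -(2 * s) * ((c + inner ℝ a (y - x)) * kernel s x y) +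
    inner ℝ a (y - x) * kernel s x y) hK
    (fun y hy => by simp only; rw [hP2 _ (hfar y hy), hP1 _ (hfar y hy), kernel]; ring),
    integral_add, integral_const_mul] at e2
  · rw [Finset.sum_congr rfl fun j _ => by
      rw [setIntegral_congr_fun (hF j) fun y hy => hH1 _ (hfacet j y hy)]] at e1
    rw [Finset.sum_congr rfl fun j _ => by
      rw [setIntegral_congr_fun (g := fun y => (c + inner ℝ a (y - x)) * kernel s x y *
        inner ℝ (y - x) (outwardNormal K j)) (hF j) fun y hy => by
          simp only [hP1 _ (hfacet j y hy), kernel]]] at e2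
    rw [← e1, ← e2]
    field_simp
    ring
  · exact ((ContinuousOn.mul (by fun_prop) hker).const_mul _).integrableOn_compact (isCompact_cell K)
  · exact (ContinuousOn.mul (by fun_prop) hker).integrableOn_compact (isCompact_cell K)

theorem le_norm_sub_of_mem_facet (K : Affine.Simplex ℝ (E d) d) {x : E d} {ε : ℝ}
    (hball : Metric.ball x ε ⊆ K.closedInterior) {j : Fin (d + 1)} {y : E d} (hy : y ∈ facet K j) :
    ε ≤ ‖y - x‖ := by
  by_contra! h
  have h1 : y ∈ K.interior := by
    rw [← interior_closedInterior]
    exact interior_maximal hball Metric.isOpen_ball (mem_ball_iff_norm.2 h)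
  have h2 := (mem_interior_iff_coord K).1 h1 j
  rw [((mem_facet_iff_coord K).1 hy).2] at h2
  exact lt_irrefl _ h2

/-- The integral of a linear function against the kernel over the punctured element around `x`. -/
theorem integral_cell_diff_ball_linear_mul_kernel (K : Affine.Simplex ℝ (E d) d)
    (hG1 : ∀ t, 0 < t → ContDiffAt ℝ 1 G t)
    (hG : ∀ t, 0 < t → HasDerivAt G (-t ^ (-(((d : ℝ) + 2 * s) / 2))) t)
    {x : E d} {ε : ℝ} (hε : 0 < ε) (hball : Metric.ball x ε ⊆ K.closedInterior) (a : E d) :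
    ∫ y in K.closedInterior \ Metric.ball x ε, inner ℝ a (y - x) * kernel s x y =
      -(1 / 2) * ∑ j, inner ℝ a (outwardNormal K j) *
        ∫ y in facet K j, G (‖y - x‖ ^ 2) ∂μHE[d - 1] := by
  obtain ⟨H, hH, hH1, hH2⟩ := exists_truncation_primitive hG1 hG (δ := ε ^ 2 / 2) (by positivity)
  have e1 := integral_simplex_gradient_radial K hH x a
  have hK := (isCompact_cell K).measurableSet
  have hF := fun j => (isCompact_facet K j).measurableSet
  have hcont : Continuous fun y : E d => 2 * deriv H (‖y - x‖ ^ 2) * inner ℝ a (y - x) := by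
    have := hH.continuous_deriv le_rfl
    fun_prop
  have hint := hcont.continuousOn.integrableOn_compact (μ := volume) (isCompact_cell K)
  -- The truncated integrand is odd about `x`, so the ball may be removed from the integral over the
  -- whole element; outside it the truncation is invisible.
  rw [← integral_inter_add_sdiff measurableSet_ball hint (t := Metric.ball x ε),
    Set.inter_eq_self_of_subset_right hball, integral_ball_eq_zero_of_odd, zero_add] at e1
  · rw [setIntegral_congr_fun (g := fun y => -2 * (inner ℝ a (y - x) * kernel s x y))
      (hK.diff measurableSet_ball) (fun y hy => by
        have h1 : ε ≤ ‖y - x‖ := by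
          by_contra! h
          exact hy.2 (mem_ball_iff_norm.2 h)
        simp only [hH2 (‖y - x‖ ^ 2) (by nlinarith), kernel]; ring), integral_const_mul] at e1
    rw [Finset.sum_congr rfl fun j _ => by
      rw [setIntegral_congr_fun (hF j) fun y hy => hH1 (‖y - x‖ ^ 2) (by
        have := le_norm_sub_of_mem_facet K hball hy
        nlinarith)]] at e1
    rw [← e1]
    ring
  · intro z
    simp [inner_neg_right]

/-- The integral of the kernel over the complement of the element around `x`. -/
theorem integral_compl_cell_kernel (K : Affine.Simplex ℝ (E d) d) (hs : 0 < s)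
    {x : E d} {ε : ℝ} (hε : 0 < ε) (hball : Metric.ball x ε ⊆ K.closedInterior) :
    ∫ y in (K.closedInterior)ᶜ, kernel s x y =
      1 / (2 * s) * ∑ j, ∫ y in facet K j, kernel s x y *
        inner ℝ (y - x) (outwardNormal K j) ∂μHE[d - 1] := by
  obtain ⟨P, hP, hP1, hP2⟩ := exists_truncation_kernel d s (δ := ε ^ 2 / 2) (by positivity)
  have hK := (isCompact_cell K).measurableSet
  have hF := fun j => (isCompact_facet K j).measurableSet
  -- The divergence of the truncated field has total integral 0, so its integral over the complement
  -- is minus the flux out of the element. The truncation alters the field only inside the ball.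
  have e1 := integral_simplex_div_radial K hP x 0 1
  have e2 := integral_div_radial_eq_zero hP hs hP1 x
  simp only [inner_zero_left, add_zero, one_mul, mul_zero] at e1
  have hcong : ∀ y ∈ (K.closedInterior)ᶜ, (d : ℝ) * P (‖y - x‖ ^ 2) +
      2 * ‖y - x‖ ^ 2 * deriv P (‖y - x‖ ^ 2) = -(2 * s) * kernel s x y := by
    intro y hy
    have h1 : ε ≤ ‖y - x‖ := by
      by_contra! h
      exact hy (hball (mem_ball_iff_norm.2 h))
    rw [hP2 (‖y - x‖ ^ 2) (by nlinarith), kernel]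
  have hcont : Continuous fun y : E d => (d : ℝ) * P (‖y - x‖ ^ 2) +
      2 * ‖y - x‖ ^ 2 * deriv P (‖y - x‖ ^ 2) := by
    have := hP.continuous_deriv le_rfl
    have := hP.continuous
    fun_prop
  have hintK := hcont.continuousOn.integrableOn_compact (μ := volume) (isCompact_cell K)
  have hintC : IntegrableOn (fun y : E d => (d : ℝ) * P (‖y - x‖ ^ 2) +
      2 * ‖y - x‖ ^ 2 * deriv P (‖y - x‖ ^ 2)) (K.closedInterior)ᶜ := by
    refine IntegrableOn.congr_fun ?_ (fun y hy => (hcong y hy).symm) hK.compl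
    exact ((integrableOn_kernel_compl_ball hs x hε).mono_set
      (Set.compl_subset_compl.2 hball)).const_mul _
  have hint := hintK.union hintC
  rw [Set.union_compl_self, integrableOn_univ] at hint
  rw [← integral_add_compl hK hint, e1, setIntegral_congr_fun hK.compl hcong,
    integral_const_mul, Finset.sum_congr rfl fun j _ => by
      rw [setIntegral_congr_fun (g := fun y => kernel s x y *
        inner ℝ (y - x) (outwardNormal K j)) (hF j) fun y hy => by
          have := le_norm_sub_of_mem_facet K hball hy
          simp only [hP1 (‖y - x‖ ^ 2) (by nlinarith), kernel]]] at e2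
  field_simp
  linarith

end Kernel


/-! ### Piecewise affine functions and assembly of the principal value -/

section Triangulation

variable {d : ℕ} {Ω : Set (E d)} {ι : Type*}

/-- A function in the Lagrange space is affine on each closed element and vanishes elsewhere. -/
theorem Triangulation.lagrangeSpace_piecewise (T : Triangulation Ω ι) {u : E d → ℝ}
    (hu : u ∈ T.lagrangeSpace) :
    (∀ i, ∃ φ : E d →ᵃ[ℝ] ℝ, ∀ y ∈ (T.cell i).closedInterior, u y = φ y) ∧
      ∀ y, (∀ i, y ∉ (T.cell i).closedInterior) → u y = 0 := by
  induction hu using Submodule.span_induction with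
  | mem v hv =>
    obtain ⟨z, -, rfl⟩ := hv
    refine ⟨fun i => ?_, fun y hy => ?_⟩
    · by_cases hz : z ∈ Set.range (T.cell i).points
      · obtain ⟨j, rfl⟩ := hz
        exact ⟨(simplexBasis (T.cell i)).coord j, fun y hy => T.nodalFunction_eq i j hy⟩
      · exact ⟨0, fun y hy => T.nodalFunction_eq_zero i hz hy⟩
    · rw [Triangulation.nodalFunction, dif_neg]
      rintro ⟨p, -, hp⟩
      exact hy _ hp
  | zero => exact ⟨fun i => ⟨0, fun y _ => rfl⟩, fun y _ => rfl⟩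
  | add v w _ _ hv hw =>
    refine ⟨fun i => ?_, fun y hy => ?_⟩
    · obtain ⟨φ, hφ⟩ := hv.1 i
      obtain ⟨ψ, hψ⟩ := hw.1 i
      exact ⟨φ + ψ, fun y hy => by simp [hφ y hy, hψ y hy]⟩
    · simp [hv.2 y hy, hw.2 y hy]
  | smul c v _ hv =>
    refine ⟨fun i => ?_, fun y hy => ?_⟩
    · obtain ⟨φ, hφ⟩ := hv.1 i
      exact ⟨c • φ, fun y hy => by simp [hφ y hy]⟩
    · simp [hv.2 y hy]

theorem exists_affineMap_eq_inner (φ : E d →ᵃ[ℝ] ℝ) (x : E d) :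
    ∃ a : E d, ∀ y, φ y = φ x + inner ℝ a (y - x) := by
  refine ⟨(InnerProductSpace.toDual ℝ (E d)).symm (LinearMap.toContinuousLinearMap φ.linear),
    fun y => ?_⟩
  rw [InnerProductSpace.toDual_symm_apply]
  have := φ.linearMap_vsub y x
  simp only [vsub_eq_sub] at this
  simp [this]

variable [NeZero d]

theorem centroid_mem_interior (K : Affine.Simplex ℝ (E d) d) : K.centroid ∈ K.interior := by
  rw [← interior_closedInterior, ← K.convexHull_eq_closedInterior]
  exact (simplexBasis K).centroid_mem_interior_convexHull

/-- On an element, a function of the Lagrange space is affine with gradient `cellGradient`. -/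
theorem Triangulation.eq_add_inner_cellGradient (T : Triangulation Ω ι) {u : E d → ℝ}
    (hu : u ∈ T.lagrangeSpace) (i : ι) :
    (∀ y ∈ (T.cell i).interior, HasGradientAt u (T.cellGradient u i) y) ∧
      ∀ x, ∃ c : ℝ, ∀ y ∈ (T.cell i).closedInterior,
        u y = c + inner ℝ (T.cellGradient u i) (y - x) := by
  obtain ⟨φ, hφ⟩ := (T.lagrangeSpace_piecewise hu).1 i
  obtain ⟨a, ha⟩ := exists_affineMap_eq_inner φ 0
  have hgrad : ∀ y ∈ (T.cell i).interior, HasGradientAt u a y := by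
    intro y hy
    have h1 : HasFDerivAt (fun y : E d => φ 0 + inner ℝ a (y - 0)) (innerSL ℝ a) y := by
      have := (innerSL ℝ a).hasFDerivAt (x := y)
      simpa using this.const_add (φ 0)
    have h2 : HasGradientAt (fun y : E d => φ 0 + inner ℝ a (y - 0)) a y := h1
    refine h2.congr_of_eventuallyEq ?_
    filter_upwards [(isOpen_simplex_interior (T.cell i)).mem_nhds hy] with z hz
    rw [hφ z ((T.cell i).interior_subset_closedInterior hz), ha]
  have hca : T.cellGradient u i = a := (hgrad _ (centroid_mem_interior _)).gradient
  rw [hca]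
  refine ⟨hgrad, fun x => ⟨φ x, fun y hy => ?_⟩⟩
  rw [hφ y hy, ha y, ha x, add_assoc, ← inner_add_right]
  congr 2
  abel

/-- Distinct elements overlap in a part of a facet. -/
theorem Triangulation.exists_inter_subset_facet (T : Triangulation Ω ι) {i j : ι} (hij : i ≠ j) :
    ∃ k, (T.cell i).closedInterior ∩ (T.cell j).closedInterior ⊆ facet (T.cell i) k := by
  -- Both cells have d + 1 vertices, so inclusion would force equality. A vertex of cell `i` that is
  -- not shared has coordinate 0 on the common face.
  have hnot : ¬ Set.range (T.cell i).points ⊆ Set.range (T.cell j).points := by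
    intro h
    refine hij (T.distinct i j (Set.eq_of_subset_of_ncard_le h ?_ (Set.finite_range _)))
    rw [Set.ncard_range_of_injective (T.cell i).independent.injective,
      Set.ncard_range_of_injective (T.cell j).independent.injective]
  obtain ⟨_, ⟨k, rfl⟩, hk⟩ := Set.not_subset.1 hnot
  refine ⟨k, fun y hy => (mem_facet_iff_coord _).2 ⟨hy.1, ?_⟩⟩
  have hmem := convexHull_subset_affineSpan (𝕜 := ℝ) _ ((T.conforming i j).le hy)
  refine AffineMap.eqOn_affineSpan (g := AffineMap.const ℝ (E d) (0 : ℝ)) ?_ hmem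
  rintro w ⟨⟨l, rfl⟩, hw⟩
  rw [coord_points, if_neg]
  · rfl
  · rintro rfl
    exact hk hw

/-- A facet lies in the frontier of a convex set, which is a null set. -/
theorem volume_facet (K : Affine.Simplex ℝ (E d) d) (k : Fin (d + 1)) :
    volume (facet K k) = 0 := by
  have hc : Convex ℝ K.closedInterior := by
    rw [← K.convexHull_eq_closedInterior]; exact convex_convexHull _ _
  refine measure_mono_null (fun y hy => ?_) (hc.addHaar_frontier volume)
  have hy' := (mem_facet_iff_coord K).1 hy
  refine ⟨subset_closure hy'.1, fun h => ?_⟩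
  rw [interior_closedInterior, mem_interior_iff_coord] at h
  exact (h k).ne' hy'.2

/-- Overlaps of distinct elements lie in facets, and there are finitely many of them. This permits
splitting the integral of `u` into a sum over elements. -/
theorem Triangulation.ae_disjoint [Finite ι] (T : Triangulation Ω ι) :
    ∀ᵐ y : E d, ∀ i j, y ∈ (T.cell i).closedInterior → y ∈ (T.cell j).closedInterior → i = j := by
  rw [ae_all_iff]; intro i
  rw [ae_all_iff]; intro j
  by_cases hij : i = j
  · exact Eventually.of_forall fun _ _ _ => hij
  obtain ⟨k, hk⟩ := T.exists_inter_subset_facet hij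
  have h0 : ∀ᵐ y, y ∉ facet (T.cell i) k := measure_eq_zero_iff_ae_notMem.1 (volume_facet _ k)
  filter_upwards [h0] with y hy h1 h2
  exact absurd (hk ⟨h1, h2⟩) hy

theorem Triangulation.notMem_of_mem_interior (T : Triangulation Ω ι) {i j : ι} (hij : i ≠ j)
    {x : E d} (hx : x ∈ (T.cell i).interior) : x ∉ (T.cell j).closedInterior := by
  intro h
  obtain ⟨k, hk⟩ := T.exists_inter_subset_facet hij
  have h1 := (mem_facet_iff_coord _).1 (hk ⟨(T.cell i).interior_subset_closedInterior hx, h⟩)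
  exact ((mem_interior_iff_coord _).1 hx k).ne' h1.2

theorem Triangulation.notMem_facet (T : Triangulation Ω ι) {i₀ : ι} {x : E d}
    (hx : x ∈ (T.cell i₀).interior) (i : ι) (j : Fin (d + 1)) : x ∉ facet (T.cell i) j := by
  intro h
  have h1 := (mem_facet_iff_coord _).1 h
  by_cases hi : i₀ = i
  · subst hi
    exact ((mem_interior_iff_coord _).1 hx j).ne' h1.2
  · exact T.notMem_of_mem_interior hi hx h1.1

/-- The principal value of a continuous piecewise affine function as a sum of boundary integrals,
for a radial primitive `G` of the kernel. -/
theorem Triangulation.hasPrincipalValue [Fintype ι] [DecidableEq ι] (T : Triangulation Ω ι)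
    {s : ℝ} (hs : 0 < s) {G : ℝ → ℝ} (hG1 : ∀ t, 0 < t → ContDiffAt ℝ 1 G t)
    (hG : ∀ t, 0 < t → HasDerivAt G (-t ^ (-(((d : ℝ) + 2 * s) / 2))) t)
    {u : E d → ℝ} (hu : u ∈ T.lagrangeSpace) {i₀ : ι} {x : E d}
    (hx : x ∈ (T.cell i₀).interior) :
    HasPrincipalValue (fun y => (u x - u y) / ‖x - y‖ ^ ((d : ℝ) + 2 * s)) x
      (1 / 2 * (∑ j, inner ℝ (T.cellGradient u i₀) (outwardNormal (T.cell i₀) j) *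
          ∫ y in facet (T.cell i₀) j, G (‖y - x‖ ^ 2) ∂μHE[d - 1]) +
        u x * (1 / (2 * s) * ∑ j, ∫ y in facet (T.cell i₀) j, kernel s x y *
          inner ℝ (y - x) (outwardNormal (T.cell i₀) j) ∂μHE[d - 1]) +
        ∑ i ∈ Finset.univ.erase i₀, 1 / (2 * s) *
          ((∑ j, ∫ y in facet (T.cell i) j, u y * kernel s x y *
            inner ℝ (y - x) (outwardNormal (T.cell i) j) ∂μHE[d - 1]) + 1 / 2 *
          ∑ j, inner ℝ (T.cellGradient u i) (outwardNormal (T.cell i) j) *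
            ∫ y in facet (T.cell i) j, G (‖y - x‖ ^ 2) ∂μHE[d - 1])) := by
  set K₀ := (T.cell i₀).closedInterior with hK₀
  have hfun : (fun y => (u x - u y) / ‖x - y‖ ^ ((d : ℝ) + 2 * s)) =
      fun y => (u x - u y) * kernel s x y := by
    ext y
    rw [kernel_eq, div_eq_mul_inv]
  rw [hfun]
  have hmeas : ∀ i, MeasurableSet (T.cell i).closedInterior := fun i =>
    (isCompact_cell (T.cell i)).measurableSet
  obtain ⟨ε₀, hε₀, hball₀⟩ := Metric.isOpen_iff.1 (isOpen_simplex_interior (T.cell i₀)) x hx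
  replace hball₀ : Metric.ball x ε₀ ⊆ K₀ :=
    hball₀.trans (T.cell i₀).interior_subset_closedInterior
  choose hgrad haff using fun i => T.eq_add_inner_cellGradient hu i
  choose c hc using fun i => haff i x
  have hcx : c i₀ = u x := by
    have := hc i₀ x ((T.cell i₀).interior_subset_closedInterior hx)
    rw [sub_self, inner_zero_right, add_zero] at this
    exact this.symm
  -- integrals over the other elements
  have hxi : ∀ i ∈ Finset.univ.erase i₀, x ∉ (T.cell i).closedInterior := fun i hi =>
    T.notMem_of_mem_interior (Finset.ne_of_mem_erase hi).symm hx
  have hint : ∀ i ∈ Finset.univ.erase i₀,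
      IntegrableOn (fun y => u y * kernel s x y) (T.cell i).closedInterior := by
    intro i hi
    have h1 : ContinuousOn (kernel s x) (T.cell i).closedInterior :=
      (continuousOn_kernel s x).mono fun y hy h => hxi i hi (h ▸ hy)
    have h2 : ContinuousOn (fun y => (c i + inner ℝ (T.cellGradient u i) (y - x)) * kernel s x y)
        (T.cell i).closedInterior := ContinuousOn.mul (by fun_prop) h1
    exact (h2.integrableOn_compact (isCompact_cell _)).congr_fun
      (fun y hy => by simp only [hc i y hy]) (hmeas i)
  have hcell : ∀ i ∈ Finset.univ.erase i₀,
      ∫ y in (T.cell i).closedInterior, u y * kernel s x y = -(1 / (2 * s) *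
          ((∑ j, ∫ y in facet (T.cell i) j, u y * kernel s x y *
            inner ℝ (y - x) (outwardNormal (T.cell i) j) ∂μHE[d - 1]) + 1 / 2 *
          ∑ j, inner ℝ (T.cellGradient u i) (outwardNormal (T.cell i) j) *
            ∫ y in facet (T.cell i) j, G (‖y - x‖ ^ 2) ∂μHE[d - 1])) := by
    intro i hi
    have e := integral_cell_affine_mul_kernel (T.cell i) hs hG1 hG (hxi i hi) (c i)
      (T.cellGradient u i)
    rw [setIntegral_congr_fun (g := fun y => u y * kernel s x y) (hmeas i)
      (fun y hy => by simp only [hc i y hy])] at e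
    have hF : ∀ j, ∫ y in facet (T.cell i) j, (c i + inner ℝ (T.cellGradient u i) (y - x)) *
          kernel s x y * inner ℝ (y - x) (outwardNormal (T.cell i) j) ∂μHE[d - 1] =
        ∫ y in facet (T.cell i) j, u y * kernel s x y *
          inner ℝ (y - x) (outwardNormal (T.cell i) j) ∂μHE[d - 1] := fun j =>
      setIntegral_congr_fun (isCompact_facet _ _).measurableSet fun y hy => by
        simp only [hc i y ((mem_facet_iff_coord _).1 hy).1]
    rw [e, neg_mul, Finset.sum_congr rfl fun j _ => hF j]
  -- the complement of the element of `x`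
  have hae : (K₀ᶜ).indicator (fun y => u y * kernel s x y) =ᵐ[volume]
      fun y => ∑ i ∈ Finset.univ.erase i₀,
        (T.cell i).closedInterior.indicator (fun y => u y * kernel s x y) y := by
    filter_upwards [T.ae_disjoint] with y hy
    by_cases h0 : y ∈ K₀
    · rw [Set.indicator_of_notMem (by simpa using h0), Finset.sum_eq_zero]
      intro i hi
      exact Set.indicator_of_notMem (fun h => Finset.ne_of_mem_erase hi (hy i i₀ h h0)) _
    · rw [Set.indicator_of_mem (by simpa using h0)]
      by_cases h1 : ∃ k, y ∈ (T.cell k).closedInterior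
      · obtain ⟨k, hk⟩ := h1
        have hk0 : k ≠ i₀ := by rintro rfl; exact h0 hk
        rw [Finset.sum_eq_single_of_mem k (by simpa using hk0), Set.indicator_of_mem hk]
        intro i _ hik
        exact Set.indicator_of_notMem (fun h => hik (hy i k h hk)) _
      · push Not at h1
        rw [(T.lagrangeSpace_piecewise hu).2 y h1, zero_mul, Finset.sum_eq_zero]
        intro i _
        exact Set.indicator_of_notMem (h1 i) _
  have hint' : ∀ i ∈ Finset.univ.erase i₀, Integrable
      ((T.cell i).closedInterior.indicator (fun y => u y * kernel s x y)) := fun i hi =>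
    (integrable_indicator_iff (hmeas i)).2 (hint i hi)
  have huK : IntegrableOn (fun y => u y * kernel s x y) K₀ᶜ := by
    rw [← integrable_indicator_iff (hmeas i₀).compl]
    exact (integrable_finsetSum _ hint').congr hae.symm
  have huI : ∫ y in K₀ᶜ, u y * kernel s x y =
      ∑ i ∈ Finset.univ.erase i₀, ∫ y in (T.cell i).closedInterior, u y * kernel s x y := by
    rw [← integral_indicator (hmeas i₀).compl, integral_congr_ae hae, integral_finsetSum _ hint']
    exact Finset.sum_congr rfl fun i _ => integral_indicator (hmeas i)
  have hkK : IntegrableOn (kernel s x) K₀ᶜ :=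
    (integrableOn_kernel_compl_ball hs x hε₀).mono_set (Set.compl_subset_compl.2 hball₀)
  have hfK : IntegrableOn (fun y => (u x - u y) * kernel s x y) K₀ᶜ := by
    simp only [sub_mul]
    exact (hkK.const_mul (u x)).sub huK
  -- the punctured element
  have hnear : ∀ ε, 0 < ε → ∀ y ∈ K₀ \ Metric.ball x ε, (u x - u y) * kernel s x y =
      -(inner ℝ (T.cellGradient u i₀) (y - x) * kernel s x y) := by
    intro ε hε y hy
    rw [hc i₀ y hy.1, hcx]
    ring
  have hfn : ∀ ε, 0 < ε → IntegrableOn (fun y => (u x - u y) * kernel s x y)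
      (K₀ \ Metric.ball x ε) := by
    intro ε hε
    have h1 : ContinuousOn (kernel s x) (K₀ \ Metric.ball x ε) := by
      refine (continuousOn_kernel s x).mono ?_
      rintro y hy rfl
      exact hy.2 (Metric.mem_ball_self hε)
    have h2 : ContinuousOn (fun y => -(inner ℝ (T.cellGradient u i₀) (y - x) * kernel s x y))
        (K₀ \ Metric.ball x ε) := (ContinuousOn.mul (by fun_prop) h1).neg
    exact (h2.integrableOn_compact ((isCompact_cell _).diff Metric.isOpen_ball)).congr_fun
      (fun y hy => (hnear ε hε y hy).symm) ((hmeas i₀).diff measurableSet_ball)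
  have hsplit : ∀ ε, ε ≤ ε₀ → (Metric.ball x ε)ᶜ = K₀ \ Metric.ball x ε ∪ K₀ᶜ := by
    intro ε hε
    have := (Metric.ball_subset_ball hε).trans hball₀
    ext y
    simp only [Set.mem_compl_iff, Set.mem_union, Set.mem_sdiff]
    have := @this y
    tauto
  have hbig : ∀ ε, 0 < ε → ε ≤ ε₀ →
      IntegrableOn (fun y => (u x - u y) * kernel s x y) (Metric.ball x ε)ᶜ := by
    intro ε hε hε'
    rw [hsplit ε hε']
    exact (hfn ε hε).union hfK
  refine ⟨fun ε hε => ?_, ?_⟩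
  -- Splitting along the element requires the ball to lie inside it; a larger ball is handled by
  -- shrinking it first.
  · exact (hbig (min ε ε₀) (lt_min hε hε₀) (min_le_right _ _)).mono_set
      (Set.compl_subset_compl.2 (Metric.ball_subset_ball (min_le_left _ _)))
  -- For 0 < ε ≤ ε₀ the integral outside the ball already equals the claimed value.
  · refine tendsto_const_nhds.congr' ?_
    filter_upwards [Ioc_mem_nhdsGT hε₀] with ε hε
    rw [hsplit ε hε.2, setIntegral_union
      (disjoint_compl_right.mono_left Set.sdiff_subset) (hmeas i₀).compl (hfn ε hε.1) hfK,
      setIntegral_congr_fun ((hmeas i₀).diff measurableSet_ball) (hnear ε hε.1), integral_neg,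
      integral_cell_diff_ball_linear_mul_kernel (T.cell i₀) hG1 hG hε.1
        ((Metric.ball_subset_ball hε.2).trans hball₀)]
    have e1 : ∫ y in K₀ᶜ, (u x - u y) * kernel s x y =
        (u x * ∫ y in K₀ᶜ, kernel s x y) - ∫ y in K₀ᶜ, u y * kernel s x y := by
      simp only [sub_mul]
      rw [integral_sub (hkK.const_mul (u x)) huK, integral_const_mul]
    have e2 : ∫ y in K₀ᶜ, kernel s x y = _ :=
      integral_compl_cell_kernel (T.cell i₀) hs hε₀ hball₀
    rw [e1, huI, Finset.sum_congr rfl hcell, Finset.sum_neg_distrib, e2]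
    ring

end Triangulation


/-! ### The boundary integral formula, and its power and logarithmic cases -/

section Main

variable {d : ℕ}

theorem C_ne_zero [NeZero d] {s : ℝ} (hs0 : 0 < s) (hs1 : s < 1) : C d s ≠ 0 := by
  have h1 : 0 < Real.Gamma (s + (d : ℝ) / 2) := Real.Gamma_pos_of_pos (by positivity)
  have h2 : 0 < Real.Gamma (1 - s) := Real.Gamma_pos_of_pos (by linarith)
  have := Real.pi_pos
  rw [C]
  positivity

theorem inner_sub_div_eq_kernel (s : ℝ) (x y n : E d) :
    inner ℝ n (x - y) / ‖x - y‖ ^ ((d : ℝ) + 2 * s) = -(kernel s x y * inner ℝ (y - x) n) := by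
  rw [kernel_eq, ← neg_sub y x, inner_neg_right, norm_neg, ← norm_neg (y - x), neg_sub,
    real_inner_comm]
  ring

variable {Ω : Set (E d)} {ι : Type*} [NeZero d]

theorem boundaryRegular_of_continuousOn (K : Affine.Simplex ℝ (E d) d) {g : E d → E d → ℝ}
    (h : ∀ j, ContinuousOn (fun y => g y (outwardNormal K j)) (facet K j)) :
    BoundaryRegular K g := fun j => ⟨h j, integrableOn_facet K j (h j)⟩

theorem continuousOn_norm_rpow_facet (T : Triangulation Ω ι) {i₀ : ι} {x : E d}
    (hx : x ∈ (T.cell i₀).interior) (i : ι) (j : Fin (d + 1)) (r : ℝ) :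
    ContinuousOn (fun y => ‖x - y‖ ^ r) (facet (T.cell i) j) := by
  refine ContinuousOn.rpow_const (by fun_prop) fun y hy => Or.inl ?_
  rw [norm_ne_zero_iff, sub_ne_zero]
  rintro rfl
  exact T.notMem_facet hx i j hy

theorem norm_sub_pos_of_mem_facet (T : Triangulation Ω ι) {i₀ : ι} {x : E d}
    (hx : x ∈ (T.cell i₀).interior) {i : ι} {j : Fin (d + 1)} {y : E d}
    (hy : y ∈ facet (T.cell i) j) : 0 < ‖x - y‖ := by
  rw [norm_pos_iff, sub_ne_zero]
  rintro rfl
  exact T.notMem_facet hx i j hy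

theorem boundaryRegular_inner_sub (T : Triangulation Ω ι) (s : ℝ) {i₀ : ι} {x : E d}
    (hx : x ∈ (T.cell i₀).interior) (i : ι) :
    BoundaryRegular (T.cell i) (fun y n =>
      inner ℝ n (x - y) / ‖x - y‖ ^ ((d : ℝ) + 2 * s)) :=
  boundaryRegular_of_continuousOn _ fun j =>
    ContinuousOn.div (by fun_prop) (continuousOn_norm_rpow_facet T hx i j _) fun y hy =>
      (Real.rpow_pos_of_pos (norm_sub_pos_of_mem_facet T hx hy) _).ne'

theorem boundaryRegular_mul_inner_sub (T : Triangulation Ω ι) (s : ℝ) {u : E d → ℝ}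
    (hu : u ∈ T.lagrangeSpace) {i₀ : ι} {x : E d} (hx : x ∈ (T.cell i₀).interior) (i : ι) :
    BoundaryRegular (T.cell i) (fun y n =>
      u y * (inner ℝ n (x - y) / ‖x - y‖ ^ ((d : ℝ) + 2 * s))) := by
  refine boundaryRegular_of_continuousOn _ fun j => ?_
  obtain ⟨c, hc⟩ := (T.eq_add_inner_cellGradient hu i).2 x
  have h1 : ContinuousOn u (facet (T.cell i) j) := by
    have h2 : ContinuousOn (fun y => c + inner ℝ (T.cellGradient u i) (y - x))
      (facet (T.cell i) j) := by fun_prop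
    exact h2.congr fun y hy => hc y ((mem_facet_iff_coord _).1 hy).1
  exact h1.mul (boundaryRegular_inner_sub T s hx i j).1

/-- The boundary integral representation, for a radial primitive `G` of the kernel. -/
theorem exists_hasFracLaplacianAt [Fintype ι] [DecidableEq ι] (T : Triangulation Ω ι) {s : ℝ}
    (hs0 : 0 < s) (hs1 : s < 1) {G : ℝ → ℝ} (hG1 : ∀ t, 0 < t → ContDiffAt ℝ 1 G t)
    (hG : ∀ t, 0 < t → HasDerivAt G (-t ^ (-(((d : ℝ) + 2 * s) / 2))) t)
    {u : E d → ℝ} (hu : u ∈ T.lagrangeSpace) {i₀ : ι} {x : E d}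
    (hx : x ∈ (T.cell i₀).interior) {g : E d → ℝ} {k : ℝ} (hk : k ≠ 0)
    (hg : ∀ i j, ∀ y ∈ facet (T.cell i) j, g y = k * G (‖y - x‖ ^ 2)) :
    ∃ L : ℝ, HasFracLaplacianAt s u x L ∧
        L / C d s =
          1 / (2 * k) * boundaryIntegral (T.cell i₀) (fun y n =>
              inner ℝ (T.cellGradient u i₀) n * g y)
          - u x / (2 * s) * boundaryIntegral (T.cell i₀) (fun y n =>
              inner ℝ n (x - y) / ‖x - y‖ ^ ((d : ℝ) + 2 * s))
          + ∑ i ∈ Finset.univ.erase i₀,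
            (1 / (2 * s * (2 * k)) * boundaryIntegral (T.cell i) (fun y n =>
                  inner ℝ (T.cellGradient u i) n * g y)
              - 1 / (2 * s) * boundaryIntegral (T.cell i) (fun y n =>
                  u y * (inner ℝ n (x - y) / ‖x - y‖ ^ ((d : ℝ) + 2 * s)))) := by
  refine ⟨_, ⟨_, T.hasPrincipalValue hs0 hG1 hG hu hx, rfl⟩, ?_⟩
  rw [mul_div_cancel_left₀ _ (C_ne_zero hs0 hs1)]
  have e1 : ∀ i, boundaryIntegral (T.cell i) (fun y n =>
      inner ℝ (T.cellGradient u i) n * g y) =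
      k * ∑ j, inner ℝ (T.cellGradient u i) (outwardNormal (T.cell i) j) *
            ∫ y in facet (T.cell i) j, G (‖y - x‖ ^ 2) ∂μHE[d - 1] := by
    intro i
    rw [boundaryIntegral, Finset.mul_sum]
    refine Finset.sum_congr rfl fun j _ => ?_
    rw [integral_const_mul, setIntegral_congr_fun (isCompact_facet _ _).measurableSet (hg i j),
      integral_const_mul]
    ring
  have e2 : boundaryIntegral (T.cell i₀) (fun y n =>
      inner ℝ n (x - y) / ‖x - y‖ ^ ((d : ℝ) + 2 * s)) =
      -∑ j, ∫ y in facet (T.cell i₀) j, kernel s x y *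
          inner ℝ (y - x) (outwardNormal (T.cell i₀) j) ∂μHE[d - 1] := by
    simp only [boundaryIntegral, inner_sub_div_eq_kernel, integral_neg, Finset.sum_neg_distrib]
  have e3 : ∀ i, boundaryIntegral (T.cell i) (fun y n =>
      u y * (inner ℝ n (x - y) / ‖x - y‖ ^ ((d : ℝ) + 2 * s))) =
      -∑ j, ∫ y in facet (T.cell i) j, u y * kernel s x y *
          inner ℝ (y - x) (outwardNormal (T.cell i) j) ∂μHE[d - 1] := by
    intro i
    simp only [boundaryIntegral, inner_sub_div_eq_kernel, mul_neg, integral_neg,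
      Finset.sum_neg_distrib, mul_assoc]
  simp only [e1, e2, e3]
  congr 1
  · field_simp
    ring
  · refine Finset.sum_congr rfl fun i _ => ?_
    field_simp
    ring

end Main

end FracLap

end

theorem mainTheorem3 {d : ℕ} [NeZero d] {Ω : Set (FracLap.E d)} {ι : Type*} [Fintype ι]
    [DecidableEq ι] (T : FracLap.Triangulation Ω ι) {s : ℝ} (hs0 : 0 < s) (hs1 : s < 1)
    (u : FracLap.E d → ℝ) (hu : u ∈ T.feSpace s) (i₀ : ι) (x : FracLap.E d)
    (hx : x ∈ (T.cell i₀).interior) :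
    (∀ i, ∀ y ∈ (T.cell i).interior, HasGradientAt u (T.cellGradient u i) y) ∧
    (s ≠ 1 - (d : ℝ) / 2 →
      (∀ i, FracLap.BoundaryRegular (T.cell i) (fun y n =>
          inner ℝ (T.cellGradient u i) n / ‖x - y‖ ^ ((d : ℝ) + 2 * s - 2))) ∧
      FracLap.BoundaryRegular (T.cell i₀) (fun y n =>
          inner ℝ n (x - y) / ‖x - y‖ ^ ((d : ℝ) + 2 * s)) ∧
      (∀ i, FracLap.BoundaryRegular (T.cell i) (fun y n =>
          u y * (inner ℝ n (x - y) / ‖x - y‖ ^ ((d : ℝ) + 2 * s)))) ∧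
      ∃ L : ℝ, FracLap.HasFracLaplacianAt s u x L ∧
        L / FracLap.C d s =
          1 / ((d : ℝ) + 2 * s - 2) * FracLap.boundaryIntegral (T.cell i₀) (fun y n =>
              inner ℝ (T.cellGradient u i₀) n / ‖x - y‖ ^ ((d : ℝ) + 2 * s - 2))
          - u x / (2 * s) * FracLap.boundaryIntegral (T.cell i₀) (fun y n =>
              inner ℝ n (x - y) / ‖x - y‖ ^ ((d : ℝ) + 2 * s))
          + ∑ i ∈ Finset.univ.erase i₀,
            (1 / (2 * s * ((d : ℝ) + 2 * s - 2)) *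
                FracLap.boundaryIntegral (T.cell i) (fun y n =>
                  inner ℝ (T.cellGradient u i) n / ‖x - y‖ ^ ((d : ℝ) + 2 * s - 2))
              - 1 / (2 * s) * FracLap.boundaryIntegral (T.cell i) (fun y n =>
                  u y * (inner ℝ n (x - y) / ‖x - y‖ ^ ((d : ℝ) + 2 * s))))) ∧
    (s = 1 - (d : ℝ) / 2 →
      (∀ i, FracLap.BoundaryRegular (T.cell i) (fun y n =>
          inner ℝ (T.cellGradient u i) n * Real.log (1 / ‖x - y‖))) ∧
      FracLap.BoundaryRegular (T.cell i₀) (fun y n =>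
          inner ℝ n (x - y) / ‖x - y‖ ^ ((d : ℝ) + 2 * s)) ∧
      (∀ i, FracLap.BoundaryRegular (T.cell i) (fun y n =>
          u y * (inner ℝ n (x - y) / ‖x - y‖ ^ 2))) ∧
      ∃ L : ℝ, FracLap.HasFracLaplacianAt s u x L ∧
        L / FracLap.C d s =
          FracLap.boundaryIntegral (T.cell i₀) (fun y n =>
              inner ℝ (T.cellGradient u i₀) n * Real.log (1 / ‖x - y‖))
          - u x / (2 * s) * FracLap.boundaryIntegral (T.cell i₀) (fun y n =>
              inner ℝ n (x - y) / ‖x - y‖ ^ ((d : ℝ) + 2 * s))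
          + ∑ i ∈ Finset.univ.erase i₀,
            (1 / (2 * s) * FracLap.boundaryIntegral (T.cell i) (fun y n =>
                  inner ℝ (T.cellGradient u i) n * Real.log (1 / ‖x - y‖))
              - 1 / (2 * s) * FracLap.boundaryIntegral (T.cell i) (fun y n =>
                  u y * (inner ℝ n (x - y) / ‖x - y‖ ^ 2)))) := by
  have huL : u ∈ T.lagrangeSpace := hu.1
  refine ⟨fun i => (T.eq_add_inner_cellGradient huL i).1, fun hs => ?_, fun hs => ?_⟩
  · have hq : (d : ℝ) + 2 * s - 2 ≠ 0 := fun h => hs (by linarith)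
    have hq' : ((d : ℝ) + 2 * s - 2) / 2 ≠ 0 := by simpa using hq
    refine ⟨fun i => ?_, FracLap.boundaryRegular_inner_sub T s hx i₀,
      FracLap.boundaryRegular_mul_inner_sub T s huL hx, ?_⟩
    · exact FracLap.boundaryRegular_of_continuousOn _ fun j =>
        ContinuousOn.div continuousOn_const (FracLap.continuousOn_norm_rpow_facet T hx i j _)
          fun y hy => (Real.rpow_pos_of_pos (FracLap.norm_sub_pos_of_mem_facet T hx hy) _).ne'
    -- With q = d + 2s - 2, the primitive is G(t) = t^(-q/2) / (q/2), and the factor k = q/2 makes k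
    -- G(|y - x|²) equal to |x - y|^(-q).
    · have h := FracLap.exists_hasFracLaplacianAt T hs0 hs1
        (G := fun t => t ^ (-(((d : ℝ) + 2 * s - 2) / 2)) / (((d : ℝ) + 2 * s - 2) / 2))
        (fun t ht => (Real.contDiffAt_rpow_const_of_ne ht.ne').div_const _)
        (fun t ht => ((Real.hasDerivAt_rpow_const (Or.inl ht.ne')).div_const _).congr_deriv (by
          rw [show -(((d : ℝ) + 2 * s - 2) / 2) - 1 = -(((d : ℝ) + 2 * s) / 2) by ring]
          field_simp))
        huL hx (g := fun y => (‖x - y‖ ^ ((d : ℝ) + 2 * s - 2))⁻¹) hq'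
        (fun i j y hy => by
          rw [FracLap.rpow_normSq, mul_div_cancel₀ _ hq', ← Real.rpow_neg (norm_nonneg _)]
          congr 1
          ring)
      simp only [← div_eq_mul_inv, mul_div_cancel₀ _ (two_ne_zero (α := ℝ))] at h
      exact h
  · have hp1 : ((d : ℝ) + 2 * s) / 2 = 1 := by rw [hs]; ring
    have hp2 : (d : ℝ) + 2 * s = (2 : ℕ) := by rw [hs]; push_cast; ring
    have hpow : ∀ y, ‖x - y‖ ^ ((d : ℝ) + 2 * s) = ‖x - y‖ ^ 2 := fun y => by
      rw [hp2, Real.rpow_natCast]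
    have hreg := FracLap.boundaryRegular_mul_inner_sub T s huL hx
    -- Here the kernel profile is 1/t. The factor k = 1/2 undoes the square in the argument: -log(|y
    -- - x|²) / 2 = log(1/|x - y|).
    have h := FracLap.exists_hasFracLaplacianAt T hs0 hs1 (G := fun t => -Real.log t)
      (fun t ht => (Real.contDiffAt_log.2 ht.ne').neg)
      (fun t ht => by
        rw [hp1, Real.rpow_neg_one]
        exact (Real.hasDerivAt_log ht.ne').neg)
      huL hx (g := fun y => Real.log (1 / ‖x - y‖)) (k := 1 / 2) (by norm_num)
      (fun i j y hy => by
        rw [Real.log_pow, one_div, Real.log_inv, norm_sub_rev]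
        push_cast
        ring)
    refine ⟨fun i => ?_, FracLap.boundaryRegular_inner_sub T s hx i₀, fun i => ?_, ?_⟩
    · refine FracLap.boundaryRegular_of_continuousOn _ fun j =>
        continuousOn_const.mul (ContinuousOn.log (ContinuousOn.div continuousOn_const
          (by fun_prop) fun y hy => (FracLap.norm_sub_pos_of_mem_facet T hx hy).ne') fun y hy => ?_)
      exact (one_div_pos.2 (FracLap.norm_sub_pos_of_mem_facet T hx hy)).ne'
    · simpa only [hpow] using hreg i
    · obtain ⟨L, hL, e⟩ := h
      refine ⟨L, hL, e.trans ?_⟩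
      simp only [hpow]
      norm_num
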